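/- Let $\Gamma$ be one of the following graphs, with diameter $d$ and with the ranked poset $P$ given. (J) The Johnson graph $J(n,k)$, $2k\le n$, $d=k$: $P$ is the set of subsets of $[n]$ ordered by inclusion and ranked by cardinality; $k$-subsets $x,y$ are adjacent iff $|x\cap y|=k-1$. (G) The Grassmann graph $J_q(n,k)$, $2k\le n$, $d=k$: $P$ is the set of subspaces of an $n$-dimensional vector space over a finite field with $q$ elements, ordered by inclusion and ranked by dimension; $k$-dimensional subspaces $x,y$ are adjacent iff $\dim(x\cap y)=k-1$. (H) The hypercube $H(n,2)$, $d=n$: $P$ is the set of vectors in $\{1,-1,0\}^n$, where $u\le w$ iff $w_i=u_i$ whenever $u_i\ne0$, ranked by the number of nonzero entries; $x,y\in\{1,-1\}^n$ are adjacent iff they differ in exactly one entry. For $0\le j\le d$ let $\Omega_j$ be the set of elements of $P$ of rank $j$, so that $X=\Omega_d$ is the vertex set of $\Gamma$. Put $\langle f,g\rangle=\sum_{x\in X}f(x)g(x)$ on $\mathbb R^X$. For $u\in P$ let $\iota_u\in\mathbb R^X$ be given by $\iota_u(x)=1$ if $u\le x$ and $\iota_u(x)=0$ otherwise. Let $\Lambda_j=\operatorname{span}\{\iota_u:u\in\Omega_j\}$,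 $V_0=\Lambda_0$, and $V_j=\Lambda_j\cap\Lambda_{j-1}^{\perp}$ for $1\le j\le d$. Let $\pi_j$ be the orthogonal projection of $\mathbb R^X$ onto $V_j$, and $\check u=\pi_j(\iota_u)$ for $u\in\Omega_j$. Let $A_i$ be the $i$-th adjacency matrix, $(A_i)_{xy}=1$ if $d(x,y)=i$ and $0$ otherwise. For $0\le m,\ell\le d$ and $z\in\Omega_m$, the number of $y\in\Omega_\ell$ with $z\le y$ (if $m\le\ell$), respectively with $y\le z$ (if $m>\ell$), depends only on $m$ and $\ell$; call it $a_m^\ell$. Each $V_j$ $(0\le j\le d)$ is nonzero, and each $A_i$ $(0\le i\le d)$ acts on $V_j$ as multiplication by a scalar $p_i(j)$. Put $$\mu_j=\sum_{i=0}^{d-j}a_{d-i}^{\,j}\,p_i(j).$$ **Theorem.** For every $j=0,\dots,d$ we have $\mu_j\ne0$, and for every $f\in V_j$ $$\sum_{u\in\Omega_j}\langle\check u,f\rangle\,\check u=\mu_j f .$$ In particular, $\sum_{u\in\Omega_j}|\langle f,\check u\rangle|^2=\mu_j\|f\|^2$ for all $f\in V_j$, and the set $\{\check u:u\in\Omega_j\}\subseteq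 V_j$ is a finite tight frame for $V_j$: there is a constant $c\ne0$ such that, summing over the distinct elements $v$ of this set, $\sum_v|\langle f,v\rangle|^2=c\,\|f\|^2$ for all $f\in V_j$. -/

import Mathlib

/-! Levels of a ranked poset, the filtration of the functions on the top level, and tight frames;
then the Johnson, Grassmann and hypercube graphs with their posets. -/

namespace LevelFrame

section General

variable {P : Type*} (rk : P → ℕ)

/-- The level `Ω_j` of a ranked poset: the elements of rank `j`. The lattice attached to a graph of
diameter `d` consists of the levels `0, …, d` and an extra greatest element, which forms the level
`d + 1` and hence never meets the levels `0, …, d` used below. -/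
def Level (j : ℕ) : Type _ := {u : P // rk u = j}

instance [Finite P] (j : ℕ) : Finite (Level rk j) :=
  inferInstanceAs (Finite {u : P // rk u = j})

noncomputable instance [Finite P] (j : ℕ) : Fintype (Level rk j) := Fintype.ofFinite _

noncomputable instance (j : ℕ) : DecidableEq (Level rk j) := Classical.decEq _

variable (d : ℕ)

/-- The space `ℝ^X` of real functions on `X = Ω_d`, with `⟪f, g⟫ = ∑ x, f x * g x`. -/
abbrev Fun [Finite P] : Type _ := EuclideanSpace ℝ (Level rk d)

variable {rk} in
/-- For `z ∈ Ω_j`: the number of `y ∈ Ω_ℓ` with `z ≤ y` if `j ≤ ℓ`, and with `y ≤ z` if `j > ℓ`. -/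
noncomputable def count [PartialOrder P] {j : ℕ} (z : Level rk j) (l : ℕ) : ℕ :=
  if j ≤ l then Nat.card {y : Level rk l // z.1 ≤ y.1}
  else Nat.card {y : Level rk l // y.1 ≤ z.1}

/-- `a_j^ℓ`: the common value of `count z ℓ` over all `z ∈ Ω_j` (an arbitrary number if there is
no common value). -/
noncomputable def a [PartialOrder P] (j l : ℕ) : ℕ :=
  Classical.epsilon fun c : ℕ => ∀ z : Level rk j, count z l = c

open Classical in
variable {rk} in
/-- `ι(z) ∈ ℝ^X`, the function `x ↦ [z ≤ x]`. -/
noncomputable def iota [PartialOrder P] [Finite P] (z : P) : Fun rk d :=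
  WithLp.toLp 2 fun x => if z ≤ x.1 then 1 else 0

/-- `Λ_j`, the span of `ι(u)`, `u ∈ Ω_j`. -/
noncomputable def Lam [PartialOrder P] [Finite P] (j : ℕ) : Submodule ℝ (Fun rk d) :=
  Submodule.span ℝ (Set.range fun u : Level rk j => iota (rk := rk) d u.1)

/-- `V_0 = Λ_0` and `V_j = Λ_j ∩ Λ_{j-1}^⊥` for `j ≥ 1`. -/
noncomputable def V [PartialOrder P] [Finite P] : ℕ → Submodule ℝ (Fun rk d)
  | 0 => Lam rk d 0
  | j + 1 => Lam rk d (j + 1) ⊓ (Lam rk d j)ᗮ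

variable {rk} in
/-- `ǔ = π_j(ι(u))` for `u ∈ Ω_j`, where `π_j` is the orthogonal projection onto `V_j`. -/
noncomputable def check [PartialOrder P] [Finite P] {j : ℕ} (u : Level rk j) : Fun rk d :=
  (V rk d j).starProjection (iota d u.1)

variable {rk d}

/-- The `i`-th adjacency matrix of a graph on `X`: its `(x, y)` entry is `[d(x, y) = i]`. -/
noncomputable def distMatrix (G : SimpleGraph (Level rk d)) (i : ℕ) :
    Matrix (Level rk d) (Level rk d) ℝ :=
  Matrix.of fun x y => if G.dist x y = i then 1 else 0

/-- `p_i(j)`: the scalar by which the `i`-th adjacency matrix acts on `V_j` (an arbitrary number if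
it does not act on `V_j` as a scalar). -/
noncomputable def p [PartialOrder P] [Finite P] (G : SimpleGraph (Level rk d)) (i j : ℕ) : ℝ :=
  Classical.epsilon fun c : ℝ =>
    ∀ f ∈ V rk d j, Matrix.toEuclideanLin (distMatrix G i) f = c • f

/-- `μ_j = ∑_{i=0}^{d-j} a_{d-i}^j p_i(j)`. -/
noncomputable def mu [PartialOrder P] [Finite P] (G : SimpleGraph (Level rk d)) (j : ℕ) : ℝ :=
  ∑ i ∈ Finset.range (d - j + 1), (a rk (d - i) j : ℝ) * p G i j

end General

/-- A finite set `S` is a finite tight frame for the subspace `W`: it lies in `W`, and there is a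
nonzero constant `c` with `∑_{v ∈ S} |⟪f, v⟫|² = c ‖f‖²` for all `f ∈ W`. -/
def IsFiniteTightFrame {E : Type*} [NormedAddCommGroup E] [InnerProductSpace ℝ E]
    (W : Submodule ℝ E) (S : Finset E) : Prop :=
  (∀ v ∈ S, v ∈ W) ∧ ∃ c : ℝ, c ≠ 0 ∧ ∀ f ∈ W, ∑ v ∈ S, |inner ℝ f v| ^ 2 = c * ‖f‖ ^ 2

open Classical in
/-- The assertion for one graph `G` on `X = Ω_d`. The first three clauses say that the numbers
`a_m^ℓ` and `p_i(j)` (hence `μ_j`) are what their names say: the counts do not depend on the chosen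
element, and each adjacency matrix acts on the nonzero space `V_j` as the scalar `p_i(j)`. -/
def HasTightFrames {P : Type*} [PartialOrder P] [Finite P] (rk : P → ℕ) (d : ℕ)
    (G : SimpleGraph (Level rk d)) : Prop :=
  (∀ m ≤ d, ∀ l ≤ d, ∀ z : Level rk m, count z l = a rk m l) ∧
  ∀ j ≤ d,
    V rk d j ≠ ⊥ ∧
    (∀ i ≤ d, ∀ f ∈ V rk d j, Matrix.toEuclideanLin (distMatrix G i) f = p G i j • f) ∧
    (∀ f ∈ V rk d j,
      ∑ u : Level rk j, (inner ℝ (check d u) f : ℝ) • check d u = mu G j • f) ∧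
    mu G j ≠ 0 ∧
    (∀ f ∈ V rk d j,
      ∑ u : Level rk j, |(inner ℝ f (check d u) : ℝ)| ^ 2 = mu G j * ‖f‖ ^ 2) ∧
    IsFiniteTightFrame (V rk d j)
      (Finset.univ.image fun u : Level rk j => (check d u : Fun rk d))

/-- The poset of subsets of an `n`-set, ranked by cardinality. -/
def setRank (n : ℕ) (s : Finset (Fin n)) : ℕ := s.card

/-- The Johnson graph `J(n, k)`: `x` and `y` are adjacent iff `|x ∩ y| = k - 1`. -/
def johnson (n k : ℕ) : SimpleGraph (Level (setRank n) k) where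
  Adj x y := (x.1 ∩ y.1).card + 1 = k
  symm := ⟨fun x y h => by rwa [Finset.inter_comm]⟩
  loopless := ⟨fun x h => by
    have hx : x.1.card = k := x.2
    rw [Finset.inter_self] at h
    omega⟩

/-- The poset of subspaces of a vector space, ranked by dimension. -/
noncomputable def dimRank (F W : Type*) [Field F] [AddCommGroup W] [Module F W]
    (s : Submodule F W) : ℕ := Module.finrank F s

instance {F W : Type*} [Field F] [Finite F] [AddCommGroup W] [Module F W]
    [FiniteDimensional F W] : Finite (Submodule F W) :=
  have : Finite W := Module.finite_of_finite F
  inferInstance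

/-- The Grassmann graph of the `k`-dimensional subspaces of `W`: `x` and `y` are adjacent iff
`dim (x ∩ y) = k - 1`. -/
noncomputable def grassmann (F W : Type*) [Field F] [AddCommGroup W] [Module F W] (k : ℕ) :
    SimpleGraph (Level (dimRank F W) k) where
  Adj x y := Module.finrank F (x.1 ⊓ y.1 : Submodule F W) + 1 = k
  symm := ⟨fun x y h => by rwa [inf_comm]⟩
  loopless := ⟨fun x h => by
    have hx : Module.finrank F x.1 = k := x.2
    rw [inf_idem] at h
    omega⟩

/-- The vectors in `{1, -1, 0}^n`, given by the set `I` of positions of the entry `1` and the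
disjoint set `J` of positions of the entry `-1`. The order is `I ⊆ I'` and `J ⊆ J'`. -/
abbrev SignedWord (n : ℕ) : Type :=
  {w : Finset (Fin n) × Finset (Fin n) // Disjoint w.1 w.2}

/-- The `i`-th entry of the vector. -/
def SignedWord.entry {n : ℕ} (w : SignedWord n) (i : Fin n) : ℤ :=
  if i ∈ w.1.1 then 1 else if i ∈ w.1.2 then -1 else 0

/-- The rank `|I ∪ J|`, the number of nonzero entries. The words of rank `n` are those in
`{1, -1}^n`. -/
def wordRank (n : ℕ) (w : SignedWord n) : ℕ := (w.1.1 ∪ w.1.2).card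

/-- The hypercube graph `H(n, 2)`: two words in `{1, -1}^n` are adjacent iff they differ in exactly
one entry. -/
def hypercube (n : ℕ) : SimpleGraph (Level (wordRank n) n) where
  Adj x y := (Finset.univ.filter fun i : Fin n =>
    SignedWord.entry x.1 i ≠ SignedWord.entry y.1 i).card = 1
  symm := ⟨fun x y h => by simpa only [ne_comm] using h⟩
  loopless := ⟨fun x h => by simp at h⟩

end LevelFrame

/-! Only a few properties of the posets matter, and `HomogeneousSemilattice` collects them.

Frame identity: the `(x, y)` entry of `∑ u, ι_u ι_uᵀ` over rank `j` counts the `u` below `x ∧ y`. It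
is `a_r^j` with `r = rk (x ∧ y)`, and `r = d - dist x y`. So the operator equals `∑ i, a_{d-i}^j
A_i` (`sum_inner_iota_smul_iota`), which is `μ_j` on `V_j`. Projecting to `V_j` replaces `ι_u` by
`ǔ`.

Eigenvalues: by homogeneity `A_i ι_u` is a function of `rk (x ∧ u)`. A unitriangular system writes
any such function as a multiple of `ι_u` plus an element of `Λ_{j-1}`. So `A_i` is a scalar on `Λ_j`
modulo `Λ_{j-1}`, and by symmetry it is that scalar on `V_j` (`distMatrix_V`).

Nonvanishing: if `V_j ≠ 0`, then `μ_j = 0` would give a nonzero `f ∈ Λ_j` orthogonal to `Λ_j`. If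
`V_j = 0` with `j > 0`, the filtration stalls at `j`. The `join` axiom propagates the stall upwards
(`Lam_succ_le`), forcing `Λ_{d-1} = ℝ^X`. This is refuted by counting for the Johnson and Grassmann
graphs, and by the parity function for the hypercube.

Distinct vectors: automorphisms permute the `ǔ` transitively, so each value is taken equally often
and passing to the set only rescales the constant. -/

namespace LevelFrame

/-- A finite ranked semilattice, with meet `inf`, whose order automorphisms act transitively on the
pairs `(x, u)` with `x` of rank `d` and with given ranks of `u` and of `x ∧ u`. -/
structure HomogeneousSemilattice {P : Type*} [PartialOrder P] (rk : P → ℕ) (d : ℕ)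
    (inf : P → P → P) : Prop where
  le_inf_iff : ∀ x y w, w ≤ inf x y ↔ w ≤ x ∧ w ≤ y
  strictMono : StrictMono rk
  exists_bot : ∃ b, rk b = 0 ∧ ∀ x, b ≤ x
  exists_between : ∀ w x, w ≤ x → rk w < rk x → ∃ u, w ≤ u ∧ u ≤ x ∧ rk u = rk w + 1
  exists_top : ∀ u, rk u ≤ d → ∃ x, rk x = d ∧ u ≤ x
  transitive : ∀ x x' u u', rk x = d → rk x' = d → rk u = rk u' →
    rk (inf x u) = rk (inf x' u') → ∃ g : P ≃o P, (∀ w, rk (g w) = rk w) ∧ g x = x' ∧ g u = u'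
  triangle : ∀ x y z, rk x = d → rk y = d → rk z = d →
    rk (inf x y) + rk (inf y z) ≤ d + rk (inf x z)
  geodesic : ∀ x y, rk x = d → rk y = d → x ≠ y →
    ∃ z, rk z = d ∧ rk (inf y z) + 1 = d ∧ rk (inf x y) < rk (inf x z)
  join : ∀ u, 0 < rk u → rk u ≤ d → ∃ v e, rk v + 1 = rk u ∧
    (∀ x, rk x = d → (u ≤ x ↔ v ≤ x ∧ e ≤ x)) ∧
    ∀ w, (∀ x, rk x = d → ¬ (w ≤ x ∧ e ≤ x)) ∨
      ∃ t, rk t ≤ rk w + 1 ∧ ∀ x, rk x = d → (t ≤ x ↔ w ≤ x ∧ e ≤ x)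

/-! ### Order, automorphisms and counts -/

section

variable {P : Type*} [PartialOrder P] {rk : P → ℕ} {d : ℕ} {inf : P → P → P}

/-- The number of elements of rank `s` below `z`. -/
noncomputable def lowerCount (rk : P → ℕ) (z : P) (s : ℕ) : ℕ :=
  Nat.card {w : Level rk s // w.1 ≤ z}

/-- The permutation of a level induced by a rank-preserving order automorphism. -/
def levelPerm (g : P ≃o P) (hg : ∀ w, rk (g w) = rk w) (j : ℕ) : Level rk j ≃ Level rk j :=
  g.toEquiv.subtypeEquiv fun w => by simp [hg]

@[simp] theorem levelPerm_val (g : P ≃o P) (hg : ∀ w, rk (g w) = rk w) {j : ℕ} (u : Level rk j) :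
    (levelPerm g hg j u).1 = g u.1 := rfl

@[simp] theorem levelPerm_symm_val (g : P ≃o P) (hg : ∀ w, rk (g w) = rk w) {j : ℕ}
    (u : Level rk j) : ((levelPerm g hg j).symm u).1 = g.symm u.1 := rfl

theorem count_map (g : P ≃o P) (hg : ∀ w, rk (g w) = rk w) {m : ℕ} (z : Level rk m) (l : ℕ) :
    count (levelPerm g hg m z) l = count z l := by
  unfold count
  split_ifs
  · exact (Nat.card_congr ((levelPerm g hg l).subtypeEquiv fun w => by simp)).symm
  · exact (Nat.card_congr ((levelPerm g hg l).subtypeEquiv fun w => by simp)).symm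

namespace HomogeneousSemilattice

section Order

variable (h : HomogeneousSemilattice rk d inf)
include h

theorem inf_le_left (x y : P) : inf x y ≤ x := ((h.le_inf_iff x y _).1 le_rfl).1

theorem inf_le_right (x y : P) : inf x y ≤ y := ((h.le_inf_iff x y _).1 le_rfl).2

theorem inf_comm (x y : P) : inf x y = inf y x :=
  le_antisymm ((h.le_inf_iff _ _ _).2 ⟨h.inf_le_right _ _, h.inf_le_left _ _⟩)
    ((h.le_inf_iff _ _ _).2 ⟨h.inf_le_right _ _, h.inf_le_left _ _⟩)

theorem inf_eq_right {x u : P} (hu : u ≤ x) : inf x u = u :=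
  le_antisymm (h.inf_le_right _ _) ((h.le_inf_iff _ _ _).2 ⟨hu, le_rfl⟩)

theorem inf_self (x : P) : inf x x = x := h.inf_eq_right le_rfl

theorem rk_mono {x y : P} (hxy : x ≤ y) : rk x ≤ rk y := h.strictMono.monotone hxy

theorem eq_of_le {x y : P} (hxy : x ≤ y) (hr : rk y ≤ rk x) : x = y := by
  by_contra hne
  exact absurd (h.strictMono (lt_of_le_of_ne hxy hne)) (by omega)

theorem map_inf (g : P ≃o P) (x y : P) : g (inf x y) = inf (g x) (g y) := by
  apply le_antisymm
  · rw [h.le_inf_iff]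
    exact ⟨g.monotone (h.inf_le_left _ _), g.monotone (h.inf_le_right _ _)⟩
  · rw [← g.symm_apply_le, h.le_inf_iff, g.symm_apply_le, g.symm_apply_le]
    exact ⟨h.inf_le_left _ _, h.inf_le_right _ _⟩

theorem exists_automorphism {u u' : P} (hu : rk u = rk u') (hd : rk u ≤ d) :
    ∃ g : P ≃o P, (∀ w, rk (g w) = rk w) ∧ g u = u' := by
  obtain ⟨x, hx, hux⟩ := h.exists_top u hd
  obtain ⟨x', hx', hux'⟩ := h.exists_top u' (hu ▸ hd)
  -- Below a top element the meet with `u` is `u` itself, so the rank condition on meets is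
  -- automatic.
  obtain ⟨g, hg, -, hgu⟩ := h.transitive x x' u u' hx hx' hu
    (by rw [h.inf_eq_right hux, h.inf_eq_right hux', hu])
  exact ⟨g, hg, hgu⟩

theorem exists_between_of_le {w x : P} (hwx : w ≤ x) {j : ℕ} (hwj : rk w ≤ j) (hjx : j ≤ rk x) :
    ∃ u, w ≤ u ∧ u ≤ x ∧ rk u = j := by
  induction j, hwj using Nat.le_induction with
  | base => exact ⟨w, le_rfl, hwx, rfl⟩
  | succ j hj ih =>
    obtain ⟨u, hwu, hux, hu⟩ := ih (by omega)
    obtain ⟨v, huv, hvx, hv⟩ := h.exists_between u x hux (by omega)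
    exact ⟨v, hwu.trans huv, hvx, by omega⟩

theorem exists_level {j : ℕ} (hj : j ≤ d) : Nonempty (Level rk j) := by
  obtain ⟨b, hb, hbx⟩ := h.exists_bot
  obtain ⟨x, hx, -⟩ := h.exists_top b (by omega)
  obtain ⟨u, -, -, hu⟩ := h.exists_between_of_le (hbx x) (by omega : rk b ≤ j) (by omega)
  exact ⟨⟨u, hu⟩⟩

theorem count_eq_a {m : ℕ} (hm : m ≤ d) (l : ℕ) (z : Level rk m) : count z l = a rk m l := by
  have key : ∀ z' : Level rk m, count z' l = count z l := fun z' => by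
    obtain ⟨g, hg, hgz⟩ := h.exists_automorphism (z.2.trans z'.2.symm) (z.2.trans_le hm)
    have : z' = levelPerm g hg m z := Subtype.ext hgz.symm
    rw [this, count_map]
  exact (Classical.epsilon_spec (p := fun c : ℕ => ∀ z : Level rk m, count z l = c) ⟨_, key⟩) z

theorem lowerCount_self (z : P) : lowerCount rk z (rk z) = 1 := by
  rw [lowerCount, Nat.card_eq_one_iff_unique]
  refine ⟨⟨fun u v => ?_⟩, ⟨⟨⟨z, rfl⟩, le_rfl⟩⟩⟩
  have hu := h.eq_of_le u.2 u.1.2.ge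
  have hv := h.eq_of_le v.2 v.1.2.ge
  exact Subtype.ext (Subtype.ext (hu.trans hv.symm))

theorem lowerCount_of_lt {z : P} {s : ℕ} (hs : rk z < s) : lowerCount rk z s = 0 := by
  rw [lowerCount, Nat.card_eq_zero]
  refine Or.inl ⟨fun w => ?_⟩
  have := h.rk_mono w.2
  have := w.1.2
  omega

theorem lowerCount_eq_a {z : P} (hz : rk z ≤ d) {l : ℕ} (hl : l ≤ rk z) :
    lowerCount rk z l = a rk (rk z) l := by
  rw [← h.count_eq_a hz l ⟨z, rfl⟩]
  unfold count
  -- For `l = rk z`, `count` takes its upward branch while `lowerCount` looks down; both equal 1.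
  split_ifs with hle
  · obtain rfl : l = rk z := le_antisymm hl hle
    rw [h.lowerCount_self, eq_comm, Nat.card_eq_one_iff_unique]
    refine ⟨⟨fun u v => ?_⟩, ⟨⟨⟨z, rfl⟩, le_rfl⟩⟩⟩
    have hu := h.eq_of_le u.2 u.1.2.le
    have hv := h.eq_of_le v.2 v.1.2.le
    exact Subtype.ext (Subtype.ext (hu.symm.trans hv))
  · rfl

end Order

/-! ### Graph distance as corank of the meet -/

section Distance

variable (h : HomogeneousSemilattice rk d inf)
include h

/-- By `triangle`, moving one end along an edge changes the rank of the meet by at most 1. -/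
theorem rk_inf_add_length {G : SimpleGraph (Level rk d)}
    (hG : ∀ x y, G.Adj x y ↔ rk (inf x.1 y.1) + 1 = d) {x y : Level rk d} (q : G.Walk x y) :
    d ≤ rk (inf x.1 y.1) + q.length := by
  induction q with
  | @nil u => rw [h.inf_self]; exact u.2.ge.trans (Nat.le_add_right _ _)
  | @cons x y z hxy q ih =>
    have h₁ := (hG _ _).1 hxy
    have h₂ := h.triangle x.1 y.1 z.1 x.2 y.2 z.2
    rw [SimpleGraph.Walk.length_cons]
    omega

/-- By `geodesic`, every `y ≠ x` has a neighbour whose meet with `x` has larger rank, so each step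
lowers the defect `d - rk (x ∧ y)`. -/
theorem exists_walk {G : SimpleGraph (Level rk d)}
    (hG : ∀ x y, G.Adj x y ↔ rk (inf x.1 y.1) + 1 = d) (x : Level rk d) (n : ℕ) :
    ∀ y : Level rk d, d ≤ rk (inf x.1 y.1) + n → ∃ q : G.Walk y x, q.length ≤ n := by
  induction n with
  | zero =>
    intro y hy
    have h₁ := h.eq_of_le (h.inf_le_left x.1 y.1) (by have := x.2; omega)
    have h₂ := h.eq_of_le (h.inf_le_right x.1 y.1) (by have := y.2; omega)
    obtain rfl : x = y := Subtype.ext (h₁.symm.trans h₂)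
    exact ⟨.nil, le_rfl⟩
  | succ n ih =>
    intro y hy
    by_cases hxy : x = y
    · subst hxy
      exact ⟨.nil, by simp⟩
    obtain ⟨z, hyz, hxz⟩ : ∃ z : Level rk d,
        rk (inf y.1 z.1) + 1 = d ∧ rk (inf x.1 y.1) < rk (inf x.1 z.1) := by
      obtain ⟨z, hz, hz'⟩ := h.geodesic x.1 y.1 x.2 y.2 fun e => hxy (Subtype.ext e)
      exact ⟨⟨z, hz⟩, hz'⟩
    obtain ⟨q, hq⟩ := ih z (by omega)
    exact ⟨.cons ((hG y z).2 hyz) q, by rw [SimpleGraph.Walk.length_cons]; omega⟩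

theorem rk_inf_add_dist {G : SimpleGraph (Level rk d)}
    (hG : ∀ x y, G.Adj x y ↔ rk (inf x.1 y.1) + 1 = d) (x y : Level rk d) :
    rk (inf x.1 y.1) + G.dist x y = d := by
  have hle : rk (inf x.1 y.1) ≤ d := (h.rk_mono (h.inf_le_left _ _)).trans_eq x.2
  obtain ⟨q, hq⟩ := h.exists_walk hG x (d - rk (inf x.1 y.1)) y (by omega)
  have h₁ := SimpleGraph.dist_le q
  rw [SimpleGraph.dist_comm] at h₁
  obtain ⟨r, hr⟩ := q.reverse.reachable.exists_walk_length_eq_dist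
  have h₂ := h.rk_inf_add_length hG r
  omega

end Distance

end HomogeneousSemilattice
end
-- The filtration by the spaces `Λ_j`
-- Forward substitution: the new coefficient is fixed by the last equation and, since `N r (j + 1) =
-- 0` for `r ≤ j`, does not disturb the earlier ones.
theorem exists_triangular_solution (N : ℕ → ℕ → ℝ) (hN : ∀ r, N r r = 1)
    (hN' : ∀ r s, r < s → N r s = 0) (φ : ℕ → ℝ) (j : ℕ) :
    ∃ c : ℕ → ℝ, ∀ r ≤ j, φ r = ∑ s ∈ Finset.range (j + 1), c s * N r s := by
  induction j with
  | zero => exact ⟨fun _ => φ 0, fun r hr => by simp [Nat.le_zero.1 hr, hN]⟩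
  | succ j ih =>
    obtain ⟨c, hc⟩ := ih
    refine ⟨Function.update c (j + 1)
      (φ (j + 1) - ∑ s ∈ Finset.range (j + 1), c s * N (j + 1) s), fun r hr => ?_⟩
    rw [Finset.sum_range_succ, Function.update_self]
    have : ∀ s ∈ Finset.range (j + 1), Function.update c (j + 1)
        (φ (j + 1) - ∑ s ∈ Finset.range (j + 1), c s * N (j + 1) s) s * N r s = c s * N r s :=
      fun s hs => by rw [Function.update_of_ne (Finset.mem_range.1 hs).ne]
    rw [Finset.sum_congr rfl this]
    rcases hr.lt_or_eq with hr | rfl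
    · rw [hN' r _ hr, mul_zero, add_zero, hc r (by omega)]
    · rw [hN]
      ring

section

variable {P : Type*} [Finite P] {rk : P → ℕ} {d : ℕ}

theorem toEuclideanLin_distMatrix_apply (G : SimpleGraph (Level rk d)) (i : ℕ) (f : Fun rk d)
    (x : Level rk d) : Matrix.toEuclideanLin (distMatrix G i) f x =
      ∑ y, (if G.dist x y = i then 1 else 0) * f y := rfl

theorem inner_eq_sum (f g : Fun rk d) : (inner ℝ f g : ℝ) = ∑ x, f x * g x := by
  simp [PiLp.inner_apply, mul_comm]

theorem fun_sum_apply {ι : Type*} (s : Finset ι) (f : ι → Fun rk d) (x : Level rk d) :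
    (∑ i ∈ s, f i) x = ∑ i ∈ s, f i x := by
  simp

variable [PartialOrder P] {inf : P → P → P}

open Classical in
theorem iota_apply (z : P) (x : Level rk d) :
    (iota d z : Fun rk d) x = if z ≤ x.1 then 1 else 0 := rfl

theorem iota_mem_Lam {j : ℕ} (u : Level rk j) : iota d u.1 ∈ Lam rk d j :=
  Submodule.subset_span ⟨u, rfl⟩

-- The elements of rank `s` below both `x` and `u` are those below the meet. These sums span the
-- functions of `rk (x ∧ u)`.
open Classical in
theorem sum_iota_apply (s : ℕ) (u : P) (x : Level rk d) (h : HomogeneousSemilattice rk d inf) :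
    (∑ w : Level rk s, if w.1 ≤ u then iota d w.1 else 0 : Fun rk d) x =
      lowerCount rk (inf x.1 u) s := by
  rw [fun_sum_apply, lowerCount, Nat.card_eq_fintype_card, Fintype.card_subtype, Finset.card_filter,
    Nat.cast_sum]
  refine Finset.sum_congr rfl fun w _ => ?_
  by_cases hw : w.1 ≤ u <;> by_cases hx : w.1 ≤ x.1 <;>
    simp [hw, hx, iota_apply, h.le_inf_iff]

variable (rk d) in
/-- The span of the functions `iota w` with `w` of rank `j - 1`; it is zero for `j = 0`. -/
noncomputable def below : ℕ → Submodule ℝ (Fun rk d)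
  | 0 => ⊥
  | j + 1 => Lam rk d j

theorem V_eq (j : ℕ) : V rk d j = Lam rk d j ⊓ (below rk d j)ᗮ := by
  cases j <;> simp [V, below]

variable (d) in
/-- The isometry of `ℝ^X` induced by a rank-preserving order automorphism. -/
noncomputable def levelIsometry (g : P ≃o P) (hg : ∀ w, rk (g w) = rk w) :
    Fun rk d ≃ₗᵢ[ℝ] Fun rk d :=
  LinearIsometryEquiv.piLpCongrLeft 2 ℝ ℝ (levelPerm g hg d)

theorem levelIsometry_iota (g : P ≃o P) (hg : ∀ w, rk (g w) = rk w) (z : P) :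
    levelIsometry d g hg (iota d z : Fun rk d) = iota d (g z) := by
  ext x
  have : levelIsometry d g hg (iota d z : Fun rk d) x =
    (iota d z : Fun rk d) ((levelPerm g hg d).symm x) := rfl
  rw [this, iota_apply, iota_apply, levelPerm_symm_val, OrderIso.le_symm_apply]

theorem map_Lam (g : P ≃o P) (hg : ∀ w, rk (g w) = rk w) (j : ℕ) :
    (Lam rk d j).map ((levelIsometry d g hg).toLinearEquiv : Fun rk d →ₗ[ℝ] Fun rk d) =
      Lam rk d j := by
  unfold Lam
  rw [Submodule.map_span, ← Set.range_comp]
  congr 1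
  conv_rhs => rw [← (levelPerm g hg j).surjective.range_comp]
  congr 1
  funext u
  exact levelIsometry_iota g hg u.1

theorem map_V (g : P ≃o P) (hg : ∀ w, rk (g w) = rk w) (j : ℕ) :
    (V rk d j).map ((levelIsometry d g hg).toLinearEquiv : Fun rk d →ₗ[ℝ] Fun rk d) = V rk d j := by
  rw [V_eq, Submodule.map_inf _ (levelIsometry d g hg).toLinearEquiv.injective, map_Lam]
  congr 1
  have : (below rk d j).map ((levelIsometry d g hg).toLinearEquiv : Fun rk d →ₗ[ℝ] Fun rk d) =
      below rk d j := by
    cases j with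
    | zero => simp [below]
    | succ j => exact map_Lam g hg j
  conv_rhs => rw [← this]
  exact Submodule.map_orthogonal_equiv _ (levelIsometry d g hg)

/-- The induced isometry preserves `V_j`, hence commutes with the projection onto it. -/
theorem check_levelPerm (g : P ≃o P) (hg : ∀ w, rk (g w) = rk w) {j : ℕ} (u : Level rk j) :
    check d (levelPerm g hg j u) = levelIsometry d g hg (check d u) := by
  have := Submodule.starProjection_map_apply (levelIsometry d g hg) (V rk d j)
    (levelIsometry d g hg (iota d u.1))
  rw [LinearIsometryEquiv.symm_apply_apply] at this
  have hV := map_V (d := d) g hg j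
  unfold check
  rw [levelPerm_val, ← levelIsometry_iota g hg, ← this]
  congr 1
  simp only [hV]

namespace HomogeneousSemilattice

variable (h : HomogeneousSemilattice rk d inf)
include h

/-- The sum of `ι_u` over the `u ≥ w` of rank `j` is `N • ι_w`: an automorphism fixing `w` and
moving `x₀` to `x` shows that the number `N` of such `u` below a top element `x ≥ w` does not depend
on `x`. -/
theorem Lam_mono {r j : ℕ} (hrj : r ≤ j) (hj : j ≤ d) : Lam rk d r ≤ Lam rk d j := by
  classical
  rw [Lam, Submodule.span_le]
  rintro _ ⟨w, rfl⟩
  obtain ⟨x₀, hx₀, hwx₀⟩ := h.exists_top w.1 (by have := w.2; omega)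
  set N : ℕ := Nat.card {u : Level rk j // w.1 ≤ u.1 ∧ u.1 ≤ x₀} with hNdef
  have hN : (N : ℝ) ≠ 0 := by
    obtain ⟨u, hwu, hux, hu⟩ := h.exists_between_of_le hwx₀ (w.2.trans_le hrj)
      (hj.trans_eq hx₀.symm)
    have : Nonempty {u : Level rk j // w.1 ≤ u.1 ∧ u.1 ≤ x₀} := ⟨⟨⟨u, hu⟩, hwu, hux⟩⟩
    exact_mod_cast Nat.card_pos.ne'
  have key : (∑ u : Level rk j, if w.1 ≤ u.1 then iota d u.1 else 0 : Fun rk d) =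
      (N : ℝ) • iota d w.1 := by
    ext x
    rw [fun_sum_apply, PiLp.smul_apply, iota_apply]
    by_cases hwx : w.1 ≤ x.1
    · obtain ⟨g, hg, hgx, hgw⟩ := h.transitive x₀ x.1 w.1 w.1 hx₀ x.2 rfl
        (by rw [h.inf_eq_right hwx, h.inf_eq_right hwx₀])
      have hcard : N = Nat.card {u : Level rk j // w.1 ≤ u.1 ∧ u.1 ≤ x.1} :=
        Nat.card_congr ((levelPerm g hg j).subtypeEquiv fun u => by
          rw [levelPerm_val, ← hgx, g.le_iff_le]
          conv_rhs => rw [← hgw, g.le_iff_le])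
      rw [hcard, Nat.card_eq_fintype_card, Fintype.card_subtype, Finset.card_filter, Nat.cast_sum,
        if_pos hwx, smul_eq_mul, mul_one]
      refine Finset.sum_congr rfl fun u _ => ?_
      by_cases hw : w.1 ≤ u.1 <;> by_cases hx : u.1 ≤ x.1 <;> simp [hw, hx, iota_apply]
    · rw [if_neg hwx, smul_zero]
      refine Finset.sum_eq_zero fun u _ => ?_
      split_ifs with hwu
      · rw [iota_apply, if_neg fun hux => hwx (hwu.trans hux)]
      · rfl
  have hmem : (∑ u : Level rk j, if w.1 ≤ u.1 then iota d u.1 else 0 : Fun rk d) ∈ Lam rk d j :=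
    Submodule.sum_mem _ fun u _ => by
      split_ifs
      · exact iota_mem_Lam u
      · exact Submodule.zero_mem _
  rw [key] at hmem
  exact (Submodule.smul_mem_iff _ hN).1 hmem

theorem Lam_le_below {r j : ℕ} (hrj : r < j) (hj : j ≤ d) : Lam rk d r ≤ below rk d j := by
  cases j with
  | zero => omega
  | succ j => exact h.Lam_mono (by omega) (by omega)

theorem below_le_Lam {j : ℕ} (hj : j ≤ d) : below rk d j ≤ Lam rk d j := by
  cases j with
  | zero => exact bot_le
  | succ j => exact h.Lam_mono (by omega) hj

/-- Expand `φ (rk (x ∧ u))` in the sums of `ι_w` over `w ≤ u` of rank `s ≤ j`. The term `s = j` is a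
multiple of `ι_u`, and the others lie in lower levels. The coefficients do not involve `u`. -/
theorem exists_sub_smul_iota_mem_below (φ : ℕ → ℝ) {j : ℕ} (hj : j ≤ d) :
    ∃ c : ℝ, ∀ u : Level rk j,
      (WithLp.toLp 2 fun x => φ (rk (inf x.1 u.1)) : Fun rk d) - c • iota d u.1 ∈
        below rk d j := by
  classical
  have hN : ∃ N : ℕ → ℕ → ℝ, (∀ r, N r r = 1) ∧ (∀ r s, r < s → N r s = 0) ∧
      ∀ z, rk z ≤ d → ∀ s, (lowerCount rk z s : ℝ) = N (rk z) s := by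
    -- `a` itself is not triangular: for `r < s` it counts upwards, and on an empty level it is
    -- arbitrary.
    refine ⟨fun r s => if r < s then 0 else if r = s then 1 else a rk r s,
      fun r => by simp, fun r s hrs => by simp [hrs], fun z hz s => ?_⟩
    dsimp only
    split_ifs with h₁ h₂
    · simp [h.lowerCount_of_lt h₁]
    · simp [← h₂, h.lowerCount_self]
    · rw [h.lowerCount_eq_a hz (by omega)]
  obtain ⟨N, hN₁, hN₂, hN⟩ := hN
  obtain ⟨c, hc⟩ := exists_triangular_solution N hN₁ hN₂ φ j
  refine ⟨c j, fun u => ?_⟩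
  have hju : (∑ w : Level rk j, if w.1 ≤ u.1 then iota d w.1 else 0 : Fun rk d) = iota d u.1 := by
    rw [Finset.sum_eq_single u]
    · simp
    · intro w _ hw
      rw [if_neg]
      exact fun hwu => hw (Subtype.ext (h.eq_of_le hwu (by rw [u.2, w.2])))
    · simp
  have key : (WithLp.toLp 2 fun x => φ (rk (inf x.1 u.1)) : Fun rk d) = ∑ s ∈ Finset.range (j + 1),
      c s • (∑ w : Level rk s, if w.1 ≤ u.1 then iota d w.1 else 0 : Fun rk d) := by
    ext x
    have hle : rk (inf x.1 u.1) ≤ j := (h.rk_mono (h.inf_le_right _ _)).trans_eq u.2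
    rw [fun_sum_apply]
    simp only [PiLp.smul_apply, sum_iota_apply _ _ _ h, smul_eq_mul, hN _ (hle.trans hj)]
    exact hc _ hle
  rw [key, Finset.sum_range_succ, hju, add_sub_cancel_right]
  refine Submodule.sum_mem _ fun s hs => Submodule.smul_mem _ _ (Submodule.sum_mem _ fun w _ => ?_)
  split_ifs
  · exact h.Lam_le_below (Finset.mem_range.1 hs) hj (iota_mem_Lam w)
  · exact Submodule.zero_mem _

end HomogeneousSemilattice
end

/-! ### Eigenvalues, the frame identity and nonvanishing -/

section

variable {P : Type*} [Finite P] {rk : P → ℕ} {d : ℕ}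

theorem inner_distMatrix (G : SimpleGraph (Level rk d)) (i : ℕ) (f g : Fun rk d) :
    (inner ℝ (Matrix.toEuclideanLin (distMatrix G i) f) g : ℝ) =
      inner ℝ f (Matrix.toEuclideanLin (distMatrix G i) g) := by
  refine Matrix.isSymmetric_toEuclideanLin_iff.2 ?_ f g
  ext x y
  simp [distMatrix, SimpleGraph.dist_comm]

variable [PartialOrder P] {inf : P → P → P}

theorem inner_check {j : ℕ} (u : Level rk j) {f : Fun rk d} (hf : f ∈ V rk d j) :
    (inner ℝ (check d u) f : ℝ) = inner ℝ (iota d u.1) f := by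
  rw [check, Submodule.inner_starProjection_left_eq_right,
    Submodule.starProjection_eq_self_iff.2 hf]

-- Each distinct value occurs `M` times in the sum over `u`, so the set has constant `c / M`.
open Classical in
theorem isFiniteTightFrame_of_fiber_card {j : ℕ} {c : ℝ} (hc : c ≠ 0) [Nonempty (Level rk j)]
    (hf : ∀ f ∈ V rk d j, ∑ u : Level rk j, |(inner ℝ f (check d u) : ℝ)| ^ 2 = c * ‖f‖ ^ 2)
    (hu : ∀ u u' : Level rk j,
      (Finset.univ.filter fun w : Level rk j => check d w = check d u).card =
        (Finset.univ.filter fun w : Level rk j => check d w = check d u').card) :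
    IsFiniteTightFrame (V rk d j)
      (Finset.univ.image fun u : Level rk j => (check d u : Fun rk d)) := by
  obtain ⟨u₀⟩ := ‹Nonempty (Level rk j)›
  set M := (Finset.univ.filter fun w : Level rk j => check d w = check d u₀).card with hMdef
  have hM : (M : ℝ) ≠ 0 :=
    Nat.cast_ne_zero.2 (Finset.card_ne_zero_of_mem (a := u₀) (by simp))
  refine ⟨fun v hv => ?_, c / M, div_ne_zero hc hM, fun f hfV => ?_⟩
  · obtain ⟨u, -, rfl⟩ := Finset.mem_image.1 hv
    exact Submodule.starProjection_apply_mem _ _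
  · have h₁ := hf f hfV
    rw [Finset.sum_comp (fun v : Fun rk d => |(inner ℝ f v : ℝ)| ^ 2)
      fun u : Level rk j => check d u] at h₁
    have h₂ : ∀ v ∈ Finset.univ.image fun u : Level rk j => (check d u : Fun rk d),
        (Finset.univ.filter fun w : Level rk j => check d w = v).card • |(inner ℝ f v : ℝ)| ^ 2 =
          M * |(inner ℝ f v : ℝ)| ^ 2 := by
      intro v hv
      obtain ⟨u, -, rfl⟩ := Finset.mem_image.1 hv
      rw [hu u u₀, nsmul_eq_mul]
    rw [Finset.sum_congr rfl h₂, ← Finset.mul_sum] at h₁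
    rw [div_mul_eq_mul_div, eq_div_iff hM, mul_comm, h₁]

theorem Lam_ne_top_of_card_lt {e : ℕ} (he : Nat.card (Level rk e) < Nat.card (Level rk d)) :
    Lam rk d e ≠ ⊤ := by
  intro htop
  have h₁ : Module.finrank ℝ (Lam rk d e) ≤ Fintype.card (Level rk e) := finrank_range_le_card _
  rw [htop, finrank_top, finrank_euclideanSpace, ← Nat.card_eq_fintype_card,
    ← Nat.card_eq_fintype_card] at h₁
  omega

namespace HomogeneousSemilattice

variable (h : HomogeneousSemilattice rk d inf)
include h

/-- An automorphism taking `u` to `u'` maps the fibre of `ǔ` bijectively onto that of `ǔ'`. -/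
theorem check_fiber_card {j : ℕ} (hj : j ≤ d) (u u' : Level rk j) :
    (Finset.univ.filter fun w : Level rk j => check d w = check d u).card =
      (Finset.univ.filter fun w : Level rk j => check d w = check d u').card := by
  obtain ⟨g, hg, hgu⟩ := h.exists_automorphism (u.2.trans u'.2.symm) (u.2.trans_le hj)
  have hu' : u' = levelPerm g hg j u := Subtype.ext hgu.symm
  refine Finset.card_equiv (levelPerm g hg j) fun w => ?_
  simp only [Finset.mem_filter, Finset.mem_univ, true_and]
  rw [hu', check_levelPerm, check_levelPerm, (levelIsometry d g hg).injective.eq_iff]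

variable {G : SimpleGraph (Level rk d)} (hG : ∀ x y, G.Adj x y ↔ rk (inf x.1 y.1) + 1 = d)
include hG

theorem exists_distMatrix_iota (i : ℕ) {j : ℕ} (hj : j ≤ d) :
    ∃ c : ℝ, ∀ u : Level rk j,
      Matrix.toEuclideanLin (distMatrix G i) (iota d u.1) - c • iota d u.1 ∈ below rk d j := by
  classical
  have hdist : ∀ x y : Level rk d, G.dist x y = d - rk (inf x.1 y.1) := fun x y => by
    have := h.rk_inf_add_dist hG x y
    omega
  obtain ⟨φ, hφ⟩ : ∃ φ : ℕ → ℝ, ∀ (u : Level rk j) (x : Level rk d),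
      Matrix.toEuclideanLin (distMatrix G i) (iota d u.1) x = φ (rk (inf x.1 u.1)) := by
    -- `φ r` is read off at one chosen pair whose meet has rank `r`. Homogeneity carries it to any
    -- other such pair, and ranks that do not occur get the value 0.
    refine ⟨fun r => if hr : ∃ q : Level rk j × Level rk d, rk (inf q.2.1 q.1.1) = r then
      Matrix.toEuclideanLin (distMatrix G i) (iota d hr.choose.1.1) hr.choose.2 else 0,
      fun u x => ?_⟩
    have hr : ∃ q : Level rk j × Level rk d, rk (inf q.2.1 q.1.1) = rk (inf x.1 u.1) :=
      ⟨(u, x), rfl⟩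
    beta_reduce
    rw [dif_pos hr]
    obtain ⟨g, hg, hgx, hgu⟩ := h.transitive _ _ _ _ x.2 hr.choose.2.2
      (u.2.trans hr.choose.1.2.symm) hr.choose_spec.symm
    rw [← hgu, toEuclideanLin_distMatrix_apply, toEuclideanLin_distMatrix_apply]
    refine Fintype.sum_equiv (levelPerm g hg d) _ _ fun y => ?_
    rw [iota_apply, iota_apply, hdist, hdist, ← hgx, levelPerm_val, ← h.map_inf, hg, g.le_iff_le]
  obtain ⟨c, hc⟩ := h.exists_sub_smul_iota_mem_below φ hj
  refine ⟨c, fun u => ?_⟩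
  convert hc u using 2
  ext x
  exact hφ u x

theorem exists_distMatrix_Lam (i : ℕ) {j : ℕ} (hj : j ≤ d) :
    ∃ c : ℝ, ∀ f ∈ Lam rk d j,
      Matrix.toEuclideanLin (distMatrix G i) f - c • f ∈ below rk d j := by
  obtain ⟨c, hc⟩ := h.exists_distMatrix_iota hG i hj
  refine ⟨c, fun f hf => ?_⟩
  have : Lam rk d j ≤ (below rk d j).comap
      (Matrix.toEuclideanLin (distMatrix G i) - c • LinearMap.id) := by
    rw [Lam, Submodule.span_le]
    rintro _ ⟨u, rfl⟩
    exact hc u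
  exact this hf

theorem distMatrix_mem_Lam (i : ℕ) {j : ℕ} (hj : j ≤ d) {f : Fun rk d} (hf : f ∈ Lam rk d j) :
    Matrix.toEuclideanLin (distMatrix G i) f ∈ Lam rk d j := by
  obtain ⟨c, hc⟩ := h.exists_distMatrix_Lam hG i hj
  have := Submodule.add_mem _ (h.below_le_Lam hj (hc f hf)) (Submodule.smul_mem _ c hf)
  rwa [sub_add_cancel] at this

theorem distMatrix_mem_below (i : ℕ) {j : ℕ} (hj : j ≤ d) {f : Fun rk d}
    (hf : f ∈ below rk d j) : Matrix.toEuclideanLin (distMatrix G i) f ∈ below rk d j := by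
  cases j with
  | zero =>
    obtain rfl : f = 0 := hf
    rw [map_zero]
    exact Submodule.zero_mem _
  | succ j => exact h.distMatrix_mem_Lam hG i (by omega) hf

/-- `A_i f - c f` lies in `below`. It is also orthogonal to `below`, because `A_i` is symmetric and
preserves `below`. Hence it is zero. -/
theorem distMatrix_V (i : ℕ) {j : ℕ} (hj : j ≤ d) {f : Fun rk d} (hf : f ∈ V rk d j) :
    Matrix.toEuclideanLin (distMatrix G i) f = p G i j • f := by
  obtain ⟨c, hc⟩ := h.exists_distMatrix_Lam hG i hj
  refine Classical.epsilon_spec (p := fun c : ℝ =>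
    ∀ f ∈ V rk d j, Matrix.toEuclideanLin (distMatrix G i) f = c • f) ⟨c, fun f hf => ?_⟩ f hf
  rw [V_eq, Submodule.mem_inf] at hf
  have h₁ := hc f hf.1
  have h₂ : Matrix.toEuclideanLin (distMatrix G i) f - c • f ∈ (below rk d j)ᗮ := by
    refine Submodule.sub_mem _ ?_ (Submodule.smul_mem _ _ hf.2)
    rw [Submodule.mem_orthogonal']
    intro g hg
    rw [inner_distMatrix]
    exact (Submodule.mem_orthogonal' _ _).1 hf.2 _ (h.distMatrix_mem_below hG i hj hg)
  exact sub_eq_zero.1 (Submodule.disjoint_def.1 (Submodule.orthogonal_disjoint _) _ h₁ h₂)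

theorem sum_inner_iota_smul_iota {j : ℕ} (hj : j ≤ d) (f : Fun rk d) :
    ∑ u : Level rk j, (inner ℝ (iota d u.1) f : ℝ) • (iota d u.1 : Fun rk d) =
      ∑ i ∈ Finset.range (d - j + 1),
        (a rk (d - i) j : ℝ) • Matrix.toEuclideanLin (distMatrix G i) f := by
  classical
  ext x
  rw [fun_sum_apply, fun_sum_apply]
  simp only [PiLp.smul_apply, toEuclideanLin_distMatrix_apply, inner_eq_sum, smul_eq_mul,
    Finset.mul_sum, Finset.sum_mul]
  rw [Finset.sum_comm, Finset.sum_comm (s := Finset.range _)]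
  refine Finset.sum_congr rfl fun y _ => ?_
  -- Compare the coefficients of `f y`. On the right only `i = dist x y` survives; it is in range
  -- exactly when `j ≤ rk (x ∧ y)`, and otherwise the count on the left is zero.
  have h₁ : ∑ u : Level rk j, (iota d u.1 : Fun rk d) y * f y * (iota d u.1 : Fun rk d) x =
      lowerCount rk (inf x.1 y.1) j * f y := by
    rw [lowerCount, Nat.card_eq_fintype_card, Fintype.card_subtype, Finset.card_filter,
      Nat.cast_sum, Finset.sum_mul]
    refine Finset.sum_congr rfl fun u _ => ?_
    by_cases hx : u.1 ≤ x.1 <;> by_cases hy : u.1 ≤ y.1 <;>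
      simp [hx, hy, iota_apply, h.le_inf_iff]
  have hd := h.rk_inf_add_dist hG x y
  rw [h₁]
  by_cases hle : j ≤ rk (inf x.1 y.1)
  · rw [Finset.sum_eq_single (G.dist x y)]
    · rw [if_pos rfl, one_mul, h.lowerCount_eq_a (by omega) hle]
      congr 3
      omega
    · intro i _ hi
      rw [if_neg hi.symm]
      ring
    · intro hi
      exact absurd (Finset.mem_range.2 (by omega)) hi
  · rw [h.lowerCount_of_lt (by omega), Finset.sum_eq_zero]
    · simp
    · intro i hi
      have := Finset.mem_range.1 hi
      rw [if_neg (by omega)]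
      ring

theorem sum_inner_iota_V {j : ℕ} (hj : j ≤ d) {f : Fun rk d} (hf : f ∈ V rk d j) :
    ∑ u : Level rk j, (inner ℝ (iota d u.1) f : ℝ) • (iota d u.1 : Fun rk d) = mu G j • f := by
  rw [h.sum_inner_iota_smul_iota hG hj, mu, Finset.sum_smul]
  refine Finset.sum_congr rfl fun i _ => ?_
  rw [h.distMatrix_V hG i hj hf, smul_smul]

theorem sum_inner_check_smul_check {j : ℕ} (hj : j ≤ d) {f : Fun rk d} (hf : f ∈ V rk d j) :
    ∑ u : Level rk j, (inner ℝ (check d u) f : ℝ) • check d u = mu G j • f := by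
  have h₁ := congrArg (V rk d j).starProjection (h.sum_inner_iota_V hG hj hf)
  rw [map_sum, map_smul, Submodule.starProjection_eq_self_iff.2 hf] at h₁
  rw [← h₁]
  refine Finset.sum_congr rfl fun u _ => ?_
  rw [inner_check u hf, map_smul, check]

theorem sum_sq_inner_check {j : ℕ} (hj : j ≤ d) {f : Fun rk d} (hf : f ∈ V rk d j) :
    ∑ u : Level rk j, |(inner ℝ f (check d u) : ℝ)| ^ 2 = mu G j * ‖f‖ ^ 2 := by
  have h₁ := congrArg (fun v => (inner ℝ v f : ℝ)) (h.sum_inner_check_smul_check hG hj hf)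
  simp only [sum_inner, real_inner_smul_left, real_inner_self_eq_norm_sq] at h₁
  rw [← h₁]
  refine Finset.sum_congr rfl fun u _ => ?_
  rw [sq_abs, real_inner_comm, sq]

theorem mu_ne_zero {j : ℕ} (hj : j ≤ d) (hV : V rk d j ≠ ⊥) : mu G j ≠ 0 := by
  intro hmu
  obtain ⟨f, hf, hf0⟩ := Submodule.exists_mem_ne_zero_of_ne_bot hV
  have h₁ := h.sum_sq_inner_check hG hj hf
  rw [hmu, zero_mul, Finset.sum_eq_zero_iff_of_nonneg fun _ _ => by positivity] at h₁
  have h₂ : ∀ u : Level rk j, (inner ℝ (iota d u.1) f : ℝ) = 0 := fun u => by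
    have := h₁ u (Finset.mem_univ _)
    rw [sq_abs, sq_eq_zero_iff, real_inner_comm, inner_check u hf] at this
    exact this
  have h₃ : f ∈ (Lam rk d j)ᗮ := by
    rw [Submodule.mem_orthogonal]
    intro g hg
    induction hg using Submodule.span_induction with
    | mem g hg => obtain ⟨u, rfl⟩ := hg; exact h₂ u
    | zero => exact inner_zero_left _
    | add g g' _ _ hg hg' => rw [inner_add_left, hg, hg', add_zero]
    | smul c g _ hg => rw [real_inner_smul_left, hg, mul_zero]
  rw [V_eq, Submodule.mem_inf] at hf
  exact hf0 (Submodule.disjoint_def.1 (Submodule.orthogonal_disjoint _) _ hf.1 h₃)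

-- Write `ι_u = ι_v ι_e` with `v` one rank lower. Multiplication by `ι_e` raises the filtration by
-- at most one level, so applying it to `ι_v ∈ Λ_{j+1} ≤ Λ_j` lands in `Λ_{j+1}`.
omit hG in
theorem Lam_succ_le {j : ℕ} (hj : j + 2 ≤ d) (hle : Lam rk d (j + 1) ≤ Lam rk d j) :
    Lam rk d (j + 2) ≤ Lam rk d (j + 1) := by
  classical
  conv_lhs => rw [Lam]
  rw [Submodule.span_le]
  rintro _ ⟨u, rfl⟩
  obtain ⟨v, e, hv, huv, he⟩ := h.join u.1 (by rw [u.2]; omega) (by rw [u.2]; omega)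
  have hvj : rk v = j + 1 := by have := u.2; omega
  let M : Fun rk d →ₗ[ℝ] Fun rk d :=
    Matrix.toEuclideanLin (Matrix.diagonal fun x => (iota d e : Fun rk d) x)
  have hM : ∀ (f : Fun rk d) x, M f x = (iota d e : Fun rk d) x * f x := fun f x =>
    Matrix.mulVec_diagonal _ _ _
  have h₁ : Lam rk d j ≤ (Lam rk d (j + 1)).comap M := by
    conv_lhs => rw [Lam]
    rw [Submodule.span_le]
    rintro _ ⟨w, rfl⟩
    show M (iota d w.1) ∈ Lam rk d (j + 1)
    rcases he w.1 with hw | ⟨t, ht, hw⟩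
    · have : M (iota d w.1) = 0 := by
        ext x
        have := hw x.1 x.2
        rw [hM, iota_apply, iota_apply]
        split_ifs <;> simp_all
      rw [this]
      exact Submodule.zero_mem _
    · have : M (iota d w.1) = iota d t := by
        ext x
        have := hw x.1 x.2
        rw [hM, iota_apply, iota_apply, iota_apply]
        split_ifs <;> simp_all
      rw [this]
      rw [w.2] at ht
      exact h.Lam_mono ht (by omega) (iota_mem_Lam ⟨t, rfl⟩)
  have h₂ : (iota d u.1 : Fun rk d) = M (iota d v) := by
    ext x
    have := huv x.1 x.2
    rw [hM, iota_apply, iota_apply, iota_apply]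
    split_ifs <;> simp_all
  show iota d u.1 ∈ Lam rk d (j + 1)
  rw [h₂]
  exact h₁ (hle (iota_mem_Lam ⟨v, hvj⟩))

omit hG in
theorem Lam_top : Lam rk d d = ⊤ := by
  classical
  rw [eq_top_iff]
  rintro f -
  have : f = ∑ x : Level rk d, f x • (iota d x.1 : Fun rk d) := by
    ext y
    rw [fun_sum_apply, Finset.sum_eq_single y]
    · simp [iota_apply]
    · intro x _ hxy
      rw [PiLp.smul_apply, iota_apply, if_neg, smul_zero]
      exact fun hle => hxy (Subtype.ext (h.eq_of_le hle (by rw [x.2, y.2])))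
    · simp
  rw [this]
  exact Submodule.sum_mem _ fun x _ => Submodule.smul_mem _ _ (iota_mem_Lam x)

omit hG in
theorem V_ne_bot (htop : ∀ e, e + 1 = d → Lam rk d e ≠ ⊤) {j : ℕ} (hj : j ≤ d) :
    V rk d j ≠ ⊥ := by
  intro hV
  -- `Λ_j` is the orthogonal sum of `below` and `V_j`.
  have hle : Lam rk d j ≤ below rk d j := by
    have := Submodule.sup_orthogonal_inf_of_hasOrthogonalProjection (h.below_le_Lam hj)
    rw [_root_.inf_comm, ← V_eq, hV, sup_bot_eq] at this
    exact this.ge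
  cases j with
  | zero =>
    classical
    obtain ⟨b, hb, hbx⟩ := h.exists_bot
    have h₁ : (iota d b : Fun rk d) = 0 := hle (iota_mem_Lam ⟨b, hb⟩)
    obtain ⟨x⟩ := h.exists_level (le_refl d)
    have h₂ : (iota d b : Fun rk d) x = 0 := by rw [h₁]; rfl
    rw [iota_apply, if_pos (hbx x.1)] at h₂
    exact one_ne_zero h₂
  | succ j =>
    have h₁ : ∀ i, j ≤ i → i + 1 ≤ d → Lam rk d (i + 1) ≤ Lam rk d i := by
      intro i hi
      induction i, hi using Nat.le_induction with
      | base => exact fun _ => hle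
      | succ i _ ih => exact fun hi => h.Lam_succ_le hi (ih (by omega))
    have h₂ := h₁ (d - 1) (by omega) (by omega)
    rw [show d - 1 + 1 = d by omega, h.Lam_top, top_le_iff] at h₂
    exact htop _ (by omega) h₂

theorem hasTightFrames (htop : ∀ e, e + 1 = d → Lam rk d e ≠ ⊤) : HasTightFrames rk d G := by
  refine ⟨fun m hm l _ z => h.count_eq_a hm l z, fun j hj => ?_⟩
  have hV := h.V_ne_bot htop hj
  have hmu := h.mu_ne_zero hG hj hV
  have := h.exists_level hj
  refine ⟨hV, fun i _ f hf => h.distMatrix_V hG i hj hf,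
    fun f hf => h.sum_inner_check_smul_check hG hj hf, hmu,
    fun f hf => h.sum_sq_inner_check hG hj hf, ?_⟩
  convert isFiniteTightFrame_of_fiber_card hmu (fun f hf => h.sum_sq_inner_check hG hj hf)
    (fun u u' => ?_)
  convert h.check_fiber_card hj u u'

end HomogeneousSemilattice
end
-- The Johnson graph
-- The cardinalities determine the sizes of all four Venn regions; bijections between corresponding
-- regions glue to a permutation.
theorem exists_perm_mem_iff {α : Type*} [Fintype α] [DecidableEq α] {x x' u u' : Finset α}
    (hx : x.card = x'.card) (hu : u.card = u'.card) (hxu : (x ∩ u).card = (x' ∩ u').card) :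
    ∃ σ : Equiv.Perm α, ∀ i, (σ i ∈ x' ↔ i ∈ x) ∧ (σ i ∈ u' ↔ i ∈ u) := by
  have key : ∀ c : Bool × Bool,
      Fintype.card {i // (decide (i ∈ x), decide (i ∈ u)) = c} =
        Fintype.card {i // (decide (i ∈ x'), decide (i ∈ u')) = c} := by
    have hα : ∀ s t : Finset α, (Finset.univ.filter fun i => i ∉ s ∧ i ∉ t) = (s ∪ t)ᶜ := by
      intro s t; ext i; simp
    have h₁ : ∀ s t : Finset α, (Finset.univ.filter fun i => i ∈ s ∧ i ∉ t) = s \ t := by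
      intro s t; ext i; simp
    have h₂ : ∀ s t : Finset α, (Finset.univ.filter fun i => i ∉ s ∧ i ∈ t) = t \ s := by
      intro s t; ext i; simp [and_comm]
    have h₃ : ∀ s t : Finset α, (Finset.univ.filter fun i => i ∈ s ∧ i ∈ t) = s ∩ t := by
      intro s t; ext i; simp
    have e₁ := Finset.card_union_add_card_inter x u
    have e₂ := Finset.card_union_add_card_inter x' u'
    have e₃ := Finset.card_sdiff_add_card_inter x u
    have e₄ := Finset.card_sdiff_add_card_inter x' u'
    have e₅ := Finset.card_sdiff_add_card_inter u x
    have e₆ := Finset.card_sdiff_add_card_inter u' x'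
    rw [Finset.inter_comm] at e₅ e₆
    rintro ⟨a | a, b | b⟩ <;>
      simp only [Fintype.card_subtype, Prod.mk.injEq, decide_eq_true_eq, decide_eq_false_iff_not,
        hα, h₁, h₂, h₃, Finset.card_compl] <;> omega
  let E := Equiv.ofFiberEquiv fun c => Fintype.equivOfCardEq (key c)
  refine ⟨E, fun i => ?_⟩
  have := Equiv.ofFiberEquiv_map (fun c => Fintype.equivOfCardEq (key c)) i
  exact ⟨decide_eq_decide.1 (Prod.ext_iff.1 this).1, decide_eq_decide.1 (Prod.ext_iff.1 this).2⟩

/-- The order automorphism of the poset of subsets induced by a permutation. -/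
def finsetOrderIso {α : Type*} (σ : Equiv.Perm α) : Finset α ≃o Finset α where
  toEquiv := σ.finsetCongr
  map_rel_iff' := by simp

theorem finsetOrderIso_eq {α : Type*} {σ : Equiv.Perm α} {x x' : Finset α}
    (hσ : ∀ i, σ i ∈ x' ↔ i ∈ x) : finsetOrderIso σ x = x' := by
  ext i
  rw [← σ.apply_symm_apply i, hσ]
  simp [finsetOrderIso]

theorem card_inter_add_card_inter_le {α : Type*} [DecidableEq α] (x y z : Finset α) :
    (x ∩ y).card + (y ∩ z).card ≤ y.card + (x ∩ z).card := by
  rw [← Finset.card_union_add_card_inter]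
  refine add_le_add (Finset.card_le_card ?_) (Finset.card_le_card ?_)
  · exact Finset.union_subset Finset.inter_subset_right Finset.inter_subset_left
  · intro i hi
    simp only [Finset.mem_inter] at hi ⊢
    exact ⟨hi.1.1, hi.2.2⟩

theorem homogeneousSemilattice_setRank {n k : ℕ} (hk : k ≤ n) :
    HomogeneousSemilattice (setRank n) k (· ∩ ·) where
  le_inf_iff _ _ _ := Finset.subset_inter_iff
  strictMono _ _ hst := Finset.card_lt_card hst
  exists_bot := ⟨∅, Finset.card_empty, Finset.empty_subset⟩
  exists_between w x hwx hlt := by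
    obtain ⟨i, hi, hiw⟩ := Finset.exists_mem_notMem_of_card_lt_card hlt
    exact ⟨insert i w, Finset.subset_insert _ _, Finset.insert_subset hi hwx,
      Finset.card_insert_of_notMem hiw⟩
  exists_top u hu := by
    obtain ⟨x, hux, hx⟩ := Finset.exists_superset_card_eq hu (by simpa using hk)
    exact ⟨x, hx, hux⟩
  transitive x x' u u' hx hx' hu hxu := by
    obtain ⟨σ, hσ⟩ := exists_perm_mem_iff (hx.trans hx'.symm) hu hxu
    exact ⟨finsetOrderIso σ, fun w => Finset.card_map _, finsetOrderIso_eq fun i => (hσ i).1,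
      finsetOrderIso_eq fun i => (hσ i).2⟩
  triangle x y z _ hy _ := hy ▸ card_inter_add_card_inter_le x y z
  geodesic x y hx hy hxy := by
    have hcard : x.card = y.card := hx.trans hy.symm
    obtain ⟨i, hix, hiy⟩ := Finset.not_subset.1 fun hs =>
      hxy (Finset.eq_of_subset_of_card_le hs hcard.ge)
    obtain ⟨j, hjy, hjx⟩ := Finset.not_subset.1 fun hs =>
      hxy (Finset.eq_of_subset_of_card_le hs hcard.le).symm
    have hiy' : i ∉ y.erase j := fun hi => hiy (Finset.mem_of_mem_erase hi)
    have hpos : 0 < y.card := Finset.card_pos.2 ⟨j, hjy⟩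
    have hy' : y.card = k := hy
    -- Exchange `j ∈ y \ x` for `i ∈ x \ y`.
    refine ⟨insert i (y.erase j), ?_, ?_, Finset.card_lt_card ?_⟩
    · show (insert i (y.erase j)).card = k
      rw [Finset.card_insert_of_notMem hiy', Finset.card_erase_of_mem hjy]
      omega
    · show (y ∩ insert i (y.erase j)).card + 1 = k
      rw [Finset.inter_insert_of_notMem hiy, Finset.inter_eq_right.2 (Finset.erase_subset _ _),
        Finset.card_erase_of_mem hjy]
      omega
    · refine (Finset.ssubset_iff_of_subset fun l hl => ?_).2 ⟨i, by simp [hix], by simp [hiy]⟩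
      rw [Finset.mem_inter] at hl ⊢
      exact ⟨hl.1, Finset.mem_insert_of_mem
        (Finset.mem_erase.2 ⟨fun e => hjx (e ▸ hl.1), hl.2⟩)⟩
  join u hu _ := by
    obtain ⟨i, hi⟩ := Finset.card_pos.1 hu
    refine ⟨u.erase i, {i}, Finset.card_erase_add_one hi, fun x _ => ?_, fun w =>
      Or.inr ⟨insert i w, Finset.card_insert_le _ _, fun x _ => ?_⟩⟩
    · conv_lhs => rw [← Finset.insert_erase hi]
      rw [Finset.insert_subset_iff, Finset.singleton_subset_iff, and_comm]
    · rw [Finset.insert_subset_iff, Finset.singleton_subset_iff, and_comm]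

theorem card_level_setRank (n j : ℕ) : Nat.card (Level (setRank n) j) = n.choose j := by
  have : Nat.card (Level (setRank n) j) = Nat.card {s : Finset (Fin n) // s.card = j} := rfl
  rw [this, Nat.card_eq_fintype_card, Fintype.card_finset_len, Fintype.card_fin]

theorem hasTightFrames_johnson (n k : ℕ) (hk : 2 * k ≤ n) :
    HasTightFrames (setRank n) k (johnson n k) := by
  refine (homogeneousSemilattice_setRank (by omega)).hasTightFrames (fun _ _ => Iff.rfl) ?_
  rintro e rfl
  refine Lam_ne_top_of_card_lt ?_
  rw [card_level_setRank, card_level_setRank]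
  have h₁ := Nat.choose_succ_right_eq n e
  have h₂ : 0 < n.choose e := Nat.choose_pos (by omega)
  -- With `C(n, e+1) (e+1) = C(n, e) (n-e)`, this would give `n - e ≤ e + 1`, against `2(e+1) ≤ n`.
  by_contra! hle
  have h₃ := Nat.mul_le_mul_right (e + 1) hle
  rw [h₁] at h₃
  have := Nat.le_of_mul_le_mul_left h₃ h₂
  omega

/-! ### The hypercube -/

namespace SignedWord

variable {n : ℕ}

theorem ext_iff' {w w' : SignedWord n} : w = w' ↔ w.1.1 = w'.1.1 ∧ w.1.2 = w'.1.2 := by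
  rw [Subtype.ext_iff, Prod.ext_iff]

theorem le_iff {w w' : SignedWord n} : w ≤ w' ↔ w.1.1 ⊆ w'.1.1 ∧ w.1.2 ⊆ w'.1.2 := Iff.rfl

theorem wordRank_eq (w : SignedWord n) : wordRank n w = w.1.1.card + w.1.2.card :=
  Finset.card_union_of_disjoint w.2

theorem notMem_snd {w : SignedWord n} {i : Fin n} (hi : i ∈ w.1.1) : i ∉ w.1.2 :=
  Finset.disjoint_left.1 w.2 hi

theorem mem_or_mem {x : SignedWord n} (hx : wordRank n x = n) (i : Fin n) :
    i ∈ x.1.1 ∨ i ∈ x.1.2 := by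
  have : x.1.1 ∪ x.1.2 = Finset.univ := 
    Finset.eq_univ_of_card _ (hx.trans (Fintype.card_fin n).symm)
  rw [← Finset.mem_union, this]
  exact Finset.mem_univ i

theorem mem_snd_iff {x : SignedWord n} (hx : wordRank n x = n) (i : Fin n) :
    i ∈ x.1.2 ↔ i ∉ x.1.1 :=
  ⟨fun h h' => notMem_snd h' h, (mem_or_mem hx i).resolve_left⟩

/-- The meet of two words: keep the entries on which they agree. -/
def meet (w w' : SignedWord n) : SignedWord n :=
  ⟨(w.1.1 ∩ w'.1.1, w.1.2 ∩ w'.1.2),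
    w.2.mono Finset.inter_subset_left Finset.inter_subset_left⟩

/-- Change the signs of the entries at the positions in `F`. -/
def flipFun (F : Finset (Fin n)) (w : SignedWord n) : SignedWord n :=
  ⟨((w.1.1 \ F) ∪ (w.1.2 ∩ F), (w.1.2 \ F) ∪ (w.1.1 ∩ F)), by
    rw [Finset.disjoint_left]
    intro i
    have := @notMem_snd n w i
    simp only [Finset.mem_union, Finset.mem_sdiff, Finset.mem_inter]
    tauto⟩

theorem flipFun_flipFun (F : Finset (Fin n)) (w : SignedWord n) :
    flipFun F (flipFun F w) = w := by
  rw [ext_iff']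
  constructor <;> ext i <;>
    simp only [flipFun, Finset.mem_union, Finset.mem_sdiff, Finset.mem_inter] <;> tauto

theorem flipFun_mono (F : Finset (Fin n)) : Monotone (flipFun F) := fun _ _ h =>
  ⟨Finset.union_subset_union (Finset.sdiff_subset_sdiff h.1 le_rfl)
      (Finset.inter_subset_inter_right h.2),
    Finset.union_subset_union (Finset.sdiff_subset_sdiff h.2 le_rfl)
      (Finset.inter_subset_inter_right h.1)⟩

/-- Sign change at the positions in `F`, as an order automorphism. -/
def flip (F : Finset (Fin n)) : SignedWord n ≃o SignedWord n where
  toFun := flipFun F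
  invFun := flipFun F
  left_inv := flipFun_flipFun F
  right_inv := flipFun_flipFun F
  map_rel_iff' := by
    intro w w'
    refine ⟨fun h => ?_, fun h => flipFun_mono F h⟩
    have := flipFun_mono F h
    simpa [flipFun_flipFun] using this

theorem mem_flip_fst {F : Finset (Fin n)} {w : SignedWord n} {i : Fin n} :
    i ∈ (flip F w).1.1 ↔ (i ∈ w.1.1 ∧ i ∉ F) ∨ (i ∈ w.1.2 ∧ i ∈ F) := by
  show i ∈ (w.1.1 \ F) ∪ (w.1.2 ∩ F) ↔ _
  rw [Finset.mem_union, Finset.mem_sdiff, Finset.mem_inter]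

theorem mem_flip_snd {F : Finset (Fin n)} {w : SignedWord n} {i : Fin n} :
    i ∈ (flip F w).1.2 ↔ (i ∈ w.1.2 ∧ i ∉ F) ∨ (i ∈ w.1.1 ∧ i ∈ F) := by
  show i ∈ (w.1.2 \ F) ∪ (w.1.1 ∩ F) ↔ _
  rw [Finset.mem_union, Finset.mem_sdiff, Finset.mem_inter]

theorem wordRank_flip (F : Finset (Fin n)) (w : SignedWord n) :
    wordRank n (flip F w) = wordRank n w := by
  show ((w.1.1 \ F) ∪ (w.1.2 ∩ F) ∪ ((w.1.2 \ F) ∪ (w.1.1 ∩ F))).card = (w.1.1 ∪ w.1.2).card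
  congr 1
  ext i
  simp only [Finset.mem_union, Finset.mem_sdiff, Finset.mem_inter]
  tauto

theorem entry_flip_singleton (i₀ : Fin n) (w : SignedWord n) (i : Fin n) :
    entry (flip {i₀} w) i = (if i = i₀ then -1 else 1) * entry w i := by
  have := @notMem_snd n w i
  simp only [entry, mem_flip_fst, mem_flip_snd, Finset.mem_singleton]
  split_ifs <;> first | rfl | (exfalso; tauto)

/-- Permutation of the positions, as an order automorphism. -/
def permute (σ : Equiv.Perm (Fin n)) : SignedWord n ≃o SignedWord n where
  toFun w := ⟨(finsetOrderIso σ w.1.1, finsetOrderIso σ w.1.2),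
    (Finset.disjoint_map σ.toEmbedding).2 w.2⟩
  invFun w := ⟨((finsetOrderIso σ).symm w.1.1, (finsetOrderIso σ).symm w.1.2),
    (Finset.disjoint_map σ.symm.toEmbedding).2 w.2⟩
  left_inv w := by simp
  right_inv w := by simp
  map_rel_iff' {w w'} := by
    rw [le_iff]
    exact and_congr (finsetOrderIso σ).le_iff_le (finsetOrderIso σ).le_iff_le

theorem wordRank_permute (σ : Equiv.Perm (Fin n)) (w : SignedWord n) :
    wordRank n (permute σ w) = wordRank n w := by
  rw [wordRank_eq, wordRank_eq]
  exact congrArg₂ (· + ·) (Finset.card_map _) (Finset.card_map _)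

/-- The word all of whose entries are `1`. -/
def ones (n : ℕ) : SignedWord n := ⟨(Finset.univ, ∅), disjoint_bot_right⟩

theorem flip_snd {x : SignedWord n} (hx : wordRank n x = n) : flip x.1.2 x = ones n := by
  rw [ext_iff']
  have := mem_or_mem hx
  have := @notMem_snd n x
  constructor <;> ext i <;>
    simp only [ones, mem_flip_fst, mem_flip_snd, Finset.mem_univ, Finset.notMem_empty] <;> grind

theorem permute_ones (σ : Equiv.Perm (Fin n)) : permute σ (ones n) = ones n := by
  rw [ext_iff']
  exact ⟨finsetOrderIso_eq fun i => by simp [ones], finsetOrderIso_eq fun i => by simp [ones]⟩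

theorem card_fst_flip {x : SignedWord n} (hx : wordRank n x = n) (u : SignedWord n) :
    (flip x.1.2 u).1.1.card = wordRank n (meet x u) := by
  show _ = ((x.1.1 ∩ u.1.1) ∪ (x.1.2 ∩ u.1.2)).card
  congr 1
  ext i
  have := mem_snd_iff hx i
  simp only [mem_flip_fst, Finset.mem_union, Finset.mem_inter]
  tauto

/-- Sign changes take `x` and `x'` to the all-ones word. The ranks then say that the images of `u`
and `u'` have equally many entries `1` and equally many `-1`, so a permutation of positions, which
fixes the all-ones word, matches them. -/
theorem exists_automorphism {x x' u u' : SignedWord n} (hx : wordRank n x = n)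
    (hx' : wordRank n x' = n) (hu : wordRank n u = wordRank n u')
    (hxu : wordRank n (meet x u) = wordRank n (meet x' u')) :
    ∃ g : SignedWord n ≃o SignedWord n, (∀ w, wordRank n (g w) = wordRank n w) ∧
      g x = x' ∧ g u = u' := by
  rw [← card_fst_flip hx, ← card_fst_flip hx'] at hxu
  rw [← wordRank_flip x.1.2 u, ← wordRank_flip x'.1.2 u', wordRank_eq, wordRank_eq] at hu
  obtain ⟨σ, hσ⟩ := exists_perm_mem_iff (u := (flip x.1.2 u).1.2)
    (u' := (flip x'.1.2 u').1.2) hxu (by omega)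
    (by rw [Finset.disjoint_iff_inter_eq_empty.1 (flip x.1.2 u).2,
      Finset.disjoint_iff_inter_eq_empty.1 (flip x'.1.2 u').2])
  refine ⟨(flip x.1.2).trans ((permute σ).trans (flip x'.1.2).symm), fun w => ?_, ?_, ?_⟩
  · exact (wordRank_flip _ _).trans ((wordRank_permute _ _).trans (wordRank_flip _ _))
  · rw [OrderIso.trans_apply, OrderIso.trans_apply, flip_snd hx, permute_ones, ← flip_snd hx',
      OrderIso.symm_apply_apply]
  · rw [OrderIso.trans_apply, OrderIso.trans_apply, OrderIso.symm_apply_eq, ext_iff']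
    exact ⟨finsetOrderIso_eq fun i => (hσ i).1, finsetOrderIso_eq fun i => (hσ i).2⟩

theorem wordRank_strictMono : StrictMono (wordRank n) := by
  intro w w' hlt
  have h₁ := Finset.card_le_card hlt.le.1
  have h₂ := Finset.card_le_card hlt.le.2
  rw [wordRank_eq, wordRank_eq]
  by_contra hle
  exact hlt.ne (ext_iff'.2 ⟨Finset.eq_of_subset_of_card_le hlt.le.1 (by omega),
    Finset.eq_of_subset_of_card_le hlt.le.2 (by omega)⟩)

theorem exists_between {w x : SignedWord n} (hwx : w ≤ x) (hlt : wordRank n w < wordRank n x) :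
    ∃ u, w ≤ u ∧ u ≤ x ∧ wordRank n u = wordRank n w + 1 := by
  simp only [wordRank_eq] at hlt ⊢
  rcases lt_or_ge w.1.1.card x.1.1.card with hI | hI
  · obtain ⟨i, hi, hiw⟩ := Finset.exists_mem_notMem_of_card_lt_card hI
    have hsub := Finset.insert_subset hi hwx.1
    refine ⟨⟨(insert i w.1.1, w.1.2), x.2.mono hsub hwx.2⟩,
      ⟨Finset.subset_insert _ _, le_rfl⟩, ⟨hsub, hwx.2⟩, ?_⟩
    dsimp only
    rw [Finset.card_insert_of_notMem hiw]
    omega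
  · obtain ⟨i, hi, hiw⟩ := Finset.exists_mem_notMem_of_card_lt_card
      (show w.1.2.card < x.1.2.card by omega)
    have hsub := Finset.insert_subset hi hwx.2
    refine ⟨⟨(w.1.1, insert i w.1.2), x.2.mono hwx.1 hsub⟩,
      ⟨le_rfl, Finset.subset_insert _ _⟩, ⟨hwx.1, hsub⟩, ?_⟩
    dsimp only
    rw [Finset.card_insert_of_notMem hiw]
    omega

theorem exists_step {x y : SignedWord n} (hx : wordRank n x = n) (hy : wordRank n y = n)
    (hxy : x ≠ y) : ∃ z, wordRank n z = n ∧ wordRank n (meet y z) + 1 = n ∧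
      wordRank n (meet x y) < wordRank n (meet x z) := by
  obtain ⟨i, hi⟩ : ∃ i, ¬ (i ∈ x.1.1 ↔ i ∈ y.1.1) := by
    by_contra! hall
    refine hxy (ext_iff'.2 ⟨Finset.ext hall, Finset.ext fun i => ?_⟩)
    rw [mem_snd_iff hx, mem_snd_iff hy, hall]
  have hxi := mem_snd_iff hx
  have hyi := mem_snd_iff hy
  -- Correct `y` at one position `i` where it disagrees with `x`.
  refine ⟨flip {i} y, (wordRank_flip _ _).trans hy, ?_, wordRank_strictMono (lt_of_le_of_ne ?_ ?_)⟩
  · have : (meet y (flip {i} y)).1.1 ∪ (meet y (flip {i} y)).1.2 = {i}ᶜ := by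
      ext l
      have := hyi l
      simp only [meet, mem_flip_fst, mem_flip_snd, Finset.mem_union, Finset.mem_inter,
        Finset.mem_singleton, Finset.mem_compl]
      tauto
    rw [wordRank, this, Finset.card_compl, Fintype.card_fin, Finset.card_singleton]
    have := i.pos
    omega
  · constructor <;> intro l <;> have := hxi l <;> have := hyi l <;>
      simp only [meet, mem_flip_fst, mem_flip_snd, Finset.mem_inter, Finset.mem_singleton] <;> grind
  · intro he
    have h₁ := Finset.ext_iff.1 (ext_iff'.1 he).1 i
    have h₂ := Finset.ext_iff.1 (ext_iff'.1 he).2 i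
    have := hxi i
    have := hyi i
    simp only [meet, mem_flip_fst, mem_flip_snd, Finset.mem_inter, Finset.mem_singleton] at h₁ h₂
    tauto

/-- Here `e` carries a single nonzero entry of `u` and `v` the others. A word `w` has no common
upper bound with `e` exactly when its entry there has the opposite sign. -/
theorem exists_join {u : SignedWord n} (hu : 0 < wordRank n u) :
    ∃ v e : SignedWord n, wordRank n v + 1 = wordRank n u ∧ (∀ x, u ≤ x ↔ v ≤ x ∧ e ≤ x) ∧
      ∀ w, (∀ x, ¬ (w ≤ x ∧ e ≤ x)) ∨
        ∃ t : SignedWord n, wordRank n t ≤ wordRank n w + 1 ∧ ∀ x, t ≤ x ↔ w ≤ x ∧ e ≤ x := by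
  obtain ⟨i, hi⟩ := Finset.card_pos.1 hu
  simp only [wordRank_eq]
  rcases Finset.mem_union.1 hi with hi | hi
  · refine ⟨⟨(u.1.1.erase i, u.1.2), u.2.mono_left (Finset.erase_subset _ _)⟩,
      ⟨({i}, ∅), disjoint_bot_right⟩, ?_, fun x => ?_, fun w => ?_⟩
    · have := Finset.card_erase_add_one hi
      dsimp only
      omega
    · conv_lhs => rw [le_iff, ← Finset.insert_erase hi, Finset.insert_subset_iff]
      simp only [le_iff, Finset.singleton_subset_iff, Finset.empty_subset]
      tauto
    · by_cases hw : i ∈ w.1.2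
      · refine Or.inl fun x hx => notMem_snd (hx.2.1 (Finset.mem_singleton_self i)) (hx.1.2 hw)
      · refine Or.inr ⟨⟨(insert i w.1.1, w.1.2), Finset.disjoint_insert_left.2 ⟨hw, w.2⟩⟩,
          ?_, fun x => ?_⟩
        · have := Finset.card_insert_le i w.1.1
          dsimp only
          omega
        · simp only [le_iff, Finset.insert_subset_iff, Finset.singleton_subset_iff,
            Finset.empty_subset]
          tauto
  · refine ⟨⟨(u.1.1, u.1.2.erase i), u.2.mono_right (Finset.erase_subset _ _)⟩,
      ⟨(∅, {i}), disjoint_bot_left⟩, ?_, fun x => ?_, fun w => ?_⟩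
    · have := Finset.card_erase_add_one hi
      dsimp only
      omega
    · conv_lhs => rw [le_iff, ← Finset.insert_erase hi, Finset.insert_subset_iff]
      simp only [le_iff, Finset.singleton_subset_iff, Finset.empty_subset]
      tauto
    · by_cases hw : i ∈ w.1.1
      · refine Or.inl fun x hx => notMem_snd (hx.1.1 hw) (hx.2.2 (Finset.mem_singleton_self i))
      · refine Or.inr ⟨⟨(w.1.1, insert i w.1.2), Finset.disjoint_insert_right.2 ⟨hw, w.2⟩⟩,
          ?_, fun x => ?_⟩
        · have := Finset.card_insert_le i w.1.2
          dsimp only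
          omega
        · simp only [le_iff, Finset.insert_subset_iff, Finset.singleton_subset_iff,
            Finset.empty_subset]
          tauto

theorem homogeneousSemilattice_wordRank (n : ℕ) :
    HomogeneousSemilattice (wordRank n) n meet where
  le_inf_iff x y w := by
    simp only [le_iff, meet, Finset.subset_inter_iff]
    tauto
  strictMono := wordRank_strictMono
  exists_bot := ⟨⟨(∅, ∅), disjoint_bot_left⟩, Finset.card_empty,
    fun _ => ⟨Finset.empty_subset _, Finset.empty_subset _⟩⟩
  exists_between _ _ := exists_between
  exists_top u _ := by
    -- Fill the zero entries of `u` with `-1`.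
    refine ⟨⟨(u.1.1, u.1.1ᶜ), disjoint_compl_right⟩, ?_, le_rfl, fun i hi => ?_⟩
    · rw [wordRank, Finset.union_compl, Finset.card_univ, Fintype.card_fin]
    · exact Finset.mem_compl.2 fun hi' => notMem_snd hi' hi
  transitive _ _ _ _ := exists_automorphism
  triangle x y z _ hy _ := by
    have h₁ := card_inter_add_card_inter_le x.1.1 y.1.1 z.1.1
    have h₂ := card_inter_add_card_inter_le x.1.2 y.1.2 z.1.2
    simp only [wordRank_eq] at hy ⊢
    simp only [meet]
    omega
  geodesic _ _ := exists_step
  join u hu _ := by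
    obtain ⟨v, e, hv, huv, he⟩ := exists_join hu
    refine ⟨v, e, hv, fun x _ => huv x, fun w => (he w).imp (fun hw x _ => hw x) ?_⟩
    rintro ⟨t, ht, hw⟩
    exact ⟨t, ht, fun x _ => hw x⟩

theorem hypercube_adj_iff (x y : Level (wordRank n) n) :
    (hypercube n).Adj x y ↔ wordRank n (meet x.1 y.1) + 1 = n := by
  have : (Finset.univ.filter fun i : Fin n => entry x.1 i ≠ entry y.1 i) =
      ((meet x.1 y.1).1.1 ∪ (meet x.1 y.1).1.2)ᶜ := by
    ext i
    have hx := mem_snd_iff x.2 i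
    have hy := mem_snd_iff y.2 i
    rw [Finset.mem_filter]
    simp only [entry, meet, Finset.mem_univ, true_and, Finset.mem_compl, Finset.mem_union,
      Finset.mem_inter, hx, hy]
    split_ifs <;> simp_all
  show (Finset.univ.filter fun i : Fin n => entry x.1 i ≠ entry y.1 i).card = 1 ↔ _
  rw [this, Finset.card_compl, Fintype.card_fin]
  show n - wordRank n (meet x.1 y.1) = 1 ↔ _
  omega

/-- Counting fails for `n ≥ 2`, as level `n - 1` has `n 2^(n-1) ≥ 2^n` elements. Instead, the parity
function `x ↦ ∏ x_i` is orthogonal to `Λ_{n-1}`: a word `w` of rank `n - 1` has a zero entry, and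
flipping that position fixes `w` but negates parity. -/
theorem Lam_wordRank_ne_top {e : ℕ} (he : e + 1 = n) : Lam (wordRank n) n e ≠ ⊤ := by
  intro htop
  let f : Fun (wordRank n) n := WithLp.toLp 2 fun x => ((∏ i, entry x.1 i : ℤ) : ℝ)
  have hf : ∀ x, f x = ((∏ i, entry x.1 i : ℤ) : ℝ) := fun _ => rfl
  have h₁ : ∀ w : Level (wordRank n) e, (inner ℝ (iota n w.1) f : ℝ) = 0 := by
    intro w
    obtain ⟨i₀, hi₀⟩ : ∃ i₀, i₀ ∉ w.1.1.1 ∪ w.1.1.2 := by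
      by_contra! hall
      have : wordRank n w.1 = n := by
        rw [wordRank, Finset.eq_univ_iff_forall.2 hall, Finset.card_univ, Fintype.card_fin]
      have := w.2
      omega
    have hw : flip {i₀} w.1 = w.1 := by
      rw [Finset.mem_union, not_or] at hi₀
      rw [ext_iff']
      constructor <;> ext i <;>
        simp only [mem_flip_fst, mem_flip_snd, Finset.mem_singleton] <;> grind
    have h₂ : ∀ x, f (levelPerm (flip {i₀}) (wordRank_flip {i₀}) n x) = - f x := by
      intro x
      rw [hf, hf, levelPerm_val]
      simp only [entry_flip_singleton, Finset.prod_mul_distrib, Finset.prod_ite_eq',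
        Finset.mem_univ, if_true]
      push_cast
      ring
    have h₃ : (inner ℝ (iota n w.1) f : ℝ) = - inner ℝ (iota n w.1) f := by
      rw [inner_eq_sum, ← Finset.sum_neg_distrib]
      rw [← (levelPerm (flip {i₀}) (wordRank_flip {i₀}) n).sum_comp]
      refine Finset.sum_congr rfl fun x _ => ?_
      rw [h₂, iota_apply, iota_apply, levelPerm_val, mul_neg]
      congr 3
      conv_lhs => rw [← hw]
      rw [(flip {i₀}).le_iff_le]
    linarith
  have h₄ : Lam (wordRank n) n e ≤ (ℝ ∙ f)ᗮ := by
    rw [Lam, Submodule.span_le]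
    rintro _ ⟨w, rfl⟩
    exact Submodule.mem_orthogonal_singleton_iff_inner_left.2 (h₁ w)
  have h₅ : (inner ℝ f f : ℝ) = 0 :=
    Submodule.mem_orthogonal_singleton_iff_inner_left.1 (h₄ (htop ▸ Submodule.mem_top))
  let x₁ : Level (wordRank n) n := ⟨ones n, by simp [wordRank, ones]⟩
  have h₆ : f x₁ = 1 := by
    rw [hf]
    simp [x₁, entry, ones]
  rw [inner_self_eq_zero.1 h₅] at h₆
  exact zero_ne_one h₆

end SignedWord

theorem hasTightFrames_hypercube (n : ℕ) : HasTightFrames (wordRank n) n (hypercube n) :=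
  (SignedWord.homogeneousSemilattice_wordRank n).hasTightFrames SignedWord.hypercube_adj_iff
    fun _ => SignedWord.Lam_wordRank_ne_top

/-! ### The Grassmann graph -/

section Subspace

variable {F W : Type*} [Field F] [AddCommGroup W] [Module F W]

/-- A linear automorphism prescribed on two complementary subspaces. -/
theorem exists_linearEquiv_of_isCompl {W' : Type*} [AddCommGroup W'] [Module F W']
    {p q : Submodule F W} {p' q' : Submodule F W'} (hpq : IsCompl p q) (hpq' : IsCompl p' q')
    (e₁ : p ≃ₗ[F] p') (e₂ : q ≃ₗ[F] q') :
    ∃ e : W ≃ₗ[F] W', (∀ a : p, e a = e₁ a) ∧ ∀ b : q, e b = e₂ b := by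
  refine ⟨(Submodule.prodEquivOfIsCompl p q hpq).symm ≪≫ₗ (e₁.prodCongr e₂) ≪≫ₗ
    Submodule.prodEquivOfIsCompl p' q' hpq', fun a => ?_, fun b => ?_⟩
  · simp
  · simp

theorem map_eq_of_finrank_eq {W' : Type*} [AddCommGroup W'] [Module F W'] [FiniteDimensional F W']
    {p : Submodule F W} {p' : Submodule F W'} (e : W ≃ₗ[F] W') (hle : ∀ a ∈ p, e a ∈ p')
    (hf : Module.finrank F p = Module.finrank F p') : p.map (e : W →ₗ[F] W') = p' := by
  refine Submodule.eq_of_le_of_finrank_eq (Submodule.map_le_iff_le_comap.2 hle) ?_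
  rw [← hf]
  exact LinearEquiv.finrank_map_eq e p

variable [FiniteDimensional F W]

theorem exists_linearEquiv_map_eq {W' : Type*} [AddCommGroup W'] [Module F W']
    [FiniteDimensional F W'] {s : Submodule F W} {s' : Submodule F W'}
    (hW : Module.finrank F W = Module.finrank F W')
    (hs : Module.finrank F s = Module.finrank F s') :
    ∃ e : W ≃ₗ[F] W', ∀ a ∈ s, e a ∈ s' := by
  obtain ⟨c, hc⟩ := exists_isCompl s
  obtain ⟨c', hc'⟩ := exists_isCompl s'
  have h₁ := Submodule.finrank_add_eq_of_isCompl hc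
  have h₂ := Submodule.finrank_add_eq_of_isCompl hc'
  obtain ⟨e, he, -⟩ := exists_linearEquiv_of_isCompl hc hc' (LinearEquiv.ofFinrankEq _ _ hs)
    (LinearEquiv.ofFinrankEq _ _ (by omega))
  exact ⟨e, fun a ha => by rw [he ⟨a, ha⟩]; exact Subtype.prop _⟩

/-- An isomorphism of subspaces respecting given smaller subspaces. -/
theorem exists_linearEquiv_of_le {s x s' x' : Submodule F W} (hsx : s ≤ x) (hsx' : s' ≤ x')
    (hx : Module.finrank F x = Module.finrank F x')
    (hs : Module.finrank F s = Module.finrank F s') :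
    ∃ e : x ≃ₗ[F] x', ∀ a : x, (a : W) ∈ s → (e a : W) ∈ s' := by
  obtain ⟨e, he⟩ := exists_linearEquiv_map_eq (s := s.comap x.subtype) (s' := s'.comap x'.subtype)
    hx (by rw [(Submodule.comapSubtypeEquivOfLe hsx).finrank_eq,
      (Submodule.comapSubtypeEquivOfLe hsx').finrank_eq, hs])
  exact ⟨e, he⟩

/-- A complement `b` of `x ∩ u` in `u` meets `x` trivially, so it extends to a complement `r` of
`x`. Isomorphisms `x ≃ x'` respecting the intersections and `r ≃ r'` taking `b` to `b'` glue to the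
required one. -/
theorem exists_linearEquiv_map_pair {x x' u u' : Submodule F W}
    (hx : Module.finrank F x = Module.finrank F x') (hu : Module.finrank F u = Module.finrank F u')
    (hxu : Module.finrank F (x ⊓ u : Submodule F W) = Module.finrank F (x' ⊓ u' : Submodule F W)) :
    ∃ e : W ≃ₗ[F] W, x.map (e : W →ₗ[F] W) = x' ∧ u.map (e : W →ₗ[F] W) = u' := by
  have key : ∀ x u : Submodule F W, ∃ b r : Submodule F W, IsCompl x r ∧ b ≤ r ∧
      x ⊓ u ⊔ b = u ∧
      Module.finrank F (x ⊓ u : Submodule F W) + Module.finrank F b = Module.finrank F u := by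
    intro x u
    obtain ⟨c, hc⟩ := exists_isCompl (x ⊓ u)
    have hsup : x ⊓ u ⊔ c ⊓ u = u := by
      rw [← sup_inf_assoc_of_le _ inf_le_right, hc.sup_eq_top, top_inf_eq]
    have hdis : Disjoint x (c ⊓ u) := by
      rw [disjoint_iff, inf_comm c u, ← inf_assoc, hc.inf_eq_bot]
    obtain ⟨r, hr, hr'⟩ := hdis.symm.exists_isCompl
    refine ⟨c ⊓ u, r, hr'.symm, hr, hsup, ?_⟩
    have := Submodule.finrank_sup_add_finrank_inf_eq (x ⊓ u) (c ⊓ u)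
    rw [hsup, (hdis.mono_left inf_le_left).eq_bot, finrank_bot] at this
    omega
  obtain ⟨b, r, hr, hb, hsup, hfin⟩ := key x u
  obtain ⟨b', r', hr', hb', hsup', hfin'⟩ := key x' u'
  have h₁ := Submodule.finrank_add_eq_of_isCompl hr
  have h₂ := Submodule.finrank_add_eq_of_isCompl hr'
  obtain ⟨e₁, he₁⟩ := exists_linearEquiv_of_le (inf_le_left : x ⊓ u ≤ x)
    (inf_le_left : x' ⊓ u' ≤ x') hx hxu
  obtain ⟨e₂, he₂⟩ := exists_linearEquiv_of_le hb hb' (by omega) (by omega)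
  obtain ⟨e, hex, her⟩ := exists_linearEquiv_of_isCompl hr hr' e₁ e₂
  refine ⟨e, map_eq_of_finrank_eq e (fun a ha => ?_) hx, map_eq_of_finrank_eq e ?_ hu⟩
  · rw [hex ⟨a, ha⟩]
    exact Subtype.prop _
  · show u ≤ u'.comap (e : W →ₗ[F] W)
    rw [← hsup, ← hsup']
    refine sup_le (fun a ha => ?_) fun a ha => ?_
    · refine Submodule.mem_sup_left ?_
      rw [LinearEquiv.coe_coe, hex ⟨a, ha.1⟩]
      exact he₁ _ ha
    · refine Submodule.mem_sup_right ?_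
      rw [LinearEquiv.coe_coe, her ⟨a, hb ha⟩]
      exact he₂ _ ha

theorem exists_finrank_eq_between {w x : Submodule F W} (hwx : w ≤ x) {j : ℕ}
    (hw : Module.finrank F w ≤ j) (hx : j ≤ Module.finrank F x) :
    ∃ u, w ≤ u ∧ u ≤ x ∧ Module.finrank F u = j := by
  induction j, hw using Nat.le_induction with
  | base => exact ⟨w, le_rfl, hwx, rfl⟩
  | succ j _ ih =>
    obtain ⟨u, hwu, hux, hu⟩ := ih (by omega)
    obtain ⟨a, hax, hau⟩ := SetLike.exists_of_lt
      (lt_of_le_of_ne hux fun he => by rw [← he] at hx; omega)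
    refine ⟨u ⊔ F ∙ a, hwu.trans le_sup_left, sup_le hux ?_, ?_⟩
    · rwa [Submodule.span_singleton_le_iff_mem]
    · rw [Submodule.finrank_sup_span_singleton hau, hu]

/-- Take a hyperplane `h` of `y` containing `x ∩ y`, and join to it a vector of `x` outside `y`. -/
theorem exists_grassmann_step {k : ℕ} {x y : Submodule F W} (hx : Module.finrank F x = k)
    (hy : Module.finrank F y = k) (hxy : x ≠ y) :
    ∃ z : Submodule F W, Module.finrank F z = k ∧
      Module.finrank F (y ⊓ z : Submodule F W) + 1 = k ∧
      Module.finrank F (x ⊓ y : Submodule F W) < Module.finrank F (x ⊓ z : Submodule F W) := by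
  have hnot : ¬ x ≤ y := fun hle => hxy (Submodule.eq_of_le_of_finrank_eq hle (hx.trans hy.symm))
  have hnot' : ¬ y ≤ x := fun hle =>
    hxy (Submodule.eq_of_le_of_finrank_eq hle (hy.trans hx.symm)).symm
  obtain ⟨a, hax, hay⟩ := SetLike.not_le_iff_exists.1 hnot
  have hlt : Module.finrank F (x ⊓ y : Submodule F W) < k :=
    (Submodule.finrank_lt_finrank_of_lt (inf_lt_right.2 hnot')).trans_eq hy
  obtain ⟨h, hh, hhy, hhk⟩ := exists_finrank_eq_between (inf_le_right : x ⊓ y ≤ y)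
    (j := k - 1) (by omega) (by omega)
  have hz : Module.finrank F (h ⊔ F ∙ a : Submodule F W) = k := by
    rw [Submodule.finrank_sup_span_singleton fun ha => hay (hhy ha)]
    omega
  have haz : a ∈ h ⊔ F ∙ a := Submodule.mem_sup_right (Submodule.mem_span_singleton_self a)
  refine ⟨h ⊔ F ∙ a, hz, ?_, Submodule.finrank_lt_finrank_of_lt ?_⟩
  · have h₁ : Module.finrank F h ≤ Module.finrank F (y ⊓ (h ⊔ F ∙ a) : Submodule F W) :=
      Submodule.finrank_mono (le_inf hhy le_sup_left)
    have h₂ : Module.finrank F (y ⊓ (h ⊔ F ∙ a) : Submodule F W) <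
        Module.finrank F (h ⊔ F ∙ a : Submodule F W) :=
      Submodule.finrank_lt_finrank_of_lt (inf_lt_right.2 fun hle => hay (hle haz))
    omega
  · refine lt_of_le_of_ne (le_inf inf_le_left (hh.trans le_sup_left)) fun he => hay ?_
    have : a ∈ x ⊓ (h ⊔ F ∙ a) := ⟨hax, haz⟩
    rw [← he] at this
    exact this.2

theorem homogeneousSemilattice_dimRank {k : ℕ} (hk : k ≤ Module.finrank F W) :
    HomogeneousSemilattice (dimRank F W) k (· ⊓ ·) where
  le_inf_iff _ _ _ := le_inf_iff
  strictMono _ _ hst := Submodule.finrank_lt_finrank_of_lt hst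
  exists_bot := ⟨⊥, finrank_bot F W, fun _ => bot_le⟩
  exists_between _ _ hwx hlt := exists_finrank_eq_between hwx (Nat.le_succ _) hlt
  exists_top u hu := by
    obtain ⟨x, hux, -, hx⟩ := exists_finrank_eq_between (le_top : u ≤ ⊤) hu
      (by rwa [finrank_top])
    exact ⟨x, hx, hux⟩
  transitive x x' u u' hx hx' hu hxu := by
    obtain ⟨e, hex, heu⟩ := exists_linearEquiv_map_pair (hx.trans hx'.symm) hu hxu
    exact ⟨Submodule.orderIsoMapComap e, fun w => LinearEquiv.finrank_map_eq e w, hex, heu⟩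
  triangle x y z _ hy _ := by
    have h₁ := Submodule.finrank_sup_add_finrank_inf_eq (x ⊓ y) (y ⊓ z)
    have h₂ := Submodule.finrank_mono (sup_le inf_le_right inf_le_left : x ⊓ y ⊔ y ⊓ z ≤ y)
    have h₃ := Submodule.finrank_mono
      (inf_le_inf inf_le_left inf_le_right : x ⊓ y ⊓ (y ⊓ z) ≤ x ⊓ z)
    simp only [dimRank] at hy ⊢
    omega
  geodesic _ _ hx hy hxy := exists_grassmann_step hx hy hxy
  join u hu _ := by
    -- `e` is a line in `u` and `v` a complement of it in `u`.
    obtain ⟨a, hau, ha⟩ := Submodule.exists_mem_ne_zero_of_ne_bot (p := u) (by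
      rintro rfl
      exact hu.ne' (finrank_bot F W))
    have hle : F ∙ a ≤ u := by rwa [Submodule.span_singleton_le_iff_mem]
    obtain ⟨c, hc⟩ := exists_isCompl (F ∙ a)
    have hsup : F ∙ a ⊔ c ⊓ u = u := by
      rw [← sup_inf_assoc_of_le _ hle, hc.sup_eq_top, top_inf_eq]
    refine ⟨c ⊓ u, F ∙ a, ?_, fun x _ => ?_, fun w => Or.inr ⟨w ⊔ F ∙ a, ?_, fun x _ => sup_le_iff⟩⟩
    · have h₁ := Submodule.finrank_sup_add_finrank_inf_eq (F ∙ a) (c ⊓ u)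
      rw [hsup, (hc.disjoint.mono_right inf_le_left).eq_bot, finrank_bot,
        finrank_span_singleton ha] at h₁
      simp only [dimRank]
      omega
    · conv_lhs => rw [← hsup]
      rw [sup_le_iff, and_comm]
    · have h₁ := Submodule.finrank_sup_add_finrank_inf_eq w (F ∙ a)
      rw [finrank_span_singleton ha] at h₁
      simp only [dimRank]
      omega

end Subspace

/-! ### Counting subspaces over a finite field -/

section Counting

variable (F W : Type*) [Field F] [AddCommGroup W] [Module F W]

/-- The number of lines in a vector space. -/
noncomputable def lineCount : ℕ := Nat.card {s : Submodule F W // Module.finrank F s = 1}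

variable [Finite F] [FiniteDimensional F W]

theorem lineCount_mul_add_one :
    lineCount F W * (Nat.card F - 1) + 1 = Nat.card F ^ Module.finrank F W := by
  have : Finite W := Module.finite_of_finite F
  rw [lineCount, ← Nat.card_congr (Projectivization.equivSubmodule F W),
    ← Projectivization.card' F W, Module.natCard_eq_pow_finrank (K := F)]

variable {F W}

theorem lineCount_lt_lineCount {W' : Type*} [AddCommGroup W'] [Module F W']
    [FiniteDimensional F W'] (hlt : Module.finrank F W < Module.finrank F W') :
    lineCount F W < lineCount F W' := by
  have h₁ := lineCount_mul_add_one F W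
  have h₂ := lineCount_mul_add_one F W'
  have h₃ := Nat.pow_lt_pow_right (Finite.one_lt_card (α := F)) hlt
  by_contra! hle
  have := Nat.mul_le_mul_right (Nat.card F - 1) hle
  omega

theorem lineCount_congr {W' : Type*} [AddCommGroup W'] [Module F W']
    [FiniteDimensional F W'] (h : Module.finrank F W = Module.finrank F W') :
    lineCount F W = lineCount F W' := by
  have h₁ := lineCount_mul_add_one F W
  have h₂ := lineCount_mul_add_one F W'
  rw [h, ← h₂] at h₁
  have := Finite.one_lt_card (α := F)
  exact Nat.eq_of_mul_eq_mul_right (by omega) (Nat.add_right_cancel h₁)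

/-- A hyperplane of `u` is determined by its annihilator, a line in the dual space, which has the
same dimension as `u`. -/
theorem card_hyperplane_le {e : ℕ} {u : Submodule F W} (hu : Module.finrank F u = e + 1) :
    Nat.card {w : Submodule F W // Module.finrank F w = e ∧ w ≤ u} ≤ lineCount F u := by
  rw [lineCount_congr (W' := Module.Dual F u) (Subspace.dual_finrank_eq).symm]
  refine Nat.card_le_card_of_injective (fun w => ⟨(w.1.comap u.subtype).dualAnnihilator, ?_⟩) ?_
  · have h₁ := Subspace.finrank_add_finrank_dualAnnihilator_eq (w.1.comap u.subtype)
    rw [(Submodule.comapSubtypeEquivOfLe w.2.2).finrank_eq, w.2.1, hu] at h₁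
    omega
  · intro w w' hww'
    have h₁ := Subspace.dualAnnihilator_inj.1 (Subtype.ext_iff.1 hww')
    have h₂ := congrArg (Submodule.map u.subtype) h₁
    rw [Submodule.map_comap_subtype, Submodule.map_comap_subtype, inf_eq_right.2 w.2.2,
      inf_eq_right.2 w'.2.2] at h₂
    exact Subtype.ext h₂

/-- A line `s` of `c` gives `w ⊔ s`, from which it is recovered by intersecting with `c`. -/
theorem lineCount_le_card_cover {e : ℕ} {w c : Submodule F W} (hw : Module.finrank F w = e)
    (hc : IsCompl w c) :
    lineCount F c ≤ Nat.card {u : Submodule F W // Module.finrank F u = e + 1 ∧ w ≤ u} := by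
  have hle : ∀ s : Submodule F c, s.map c.subtype ≤ c := fun s => Submodule.map_subtype_le _ _
  refine Nat.card_le_card_of_injective
    (fun s => ⟨w ⊔ s.1.map c.subtype, ?_, le_sup_left⟩) ?_
  · have h₁ := Submodule.finrank_sup_add_finrank_inf_eq w (s.1.map c.subtype)
    rw [(hc.disjoint.mono_right (hle s.1)).eq_bot, finrank_bot, hw,
      Submodule.finrank_map_subtype_eq, s.2] at h₁
    exact h₁
  · intro s s' hss'
    have h₁ : w ⊔ s.1.map c.subtype = w ⊔ s'.1.map c.subtype := Subtype.ext_iff.1 hss'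
    have h₂ : ∀ s : Submodule F c, (w ⊔ s.map c.subtype) ⊓ c = s.map c.subtype := fun s => by
      rw [sup_comm, sup_inf_assoc_of_le _ (hle s), hc.inf_eq_bot, sup_bot_eq]
    have h₃ : s.1.map c.subtype = s'.1.map c.subtype := by rw [← h₂ s.1, h₁, h₂]
    exact Subtype.ext (Submodule.map_injective_of_injective c.injective_subtype h₃)

/-- Double counting of the pairs `w ≤ u`: each `w` lies in at least as many `u` as there are lines
in dimension `dim W - e ≥ e + 2`, and each `u` contains at most as many `w` as there are lines in
dimension `e + 1`. -/
theorem card_level_dimRank_lt {e : ℕ} (he : 2 * (e + 1) ≤ Module.finrank F W) :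
    Nat.card (Level (dimRank F W) e) < Nat.card (Level (dimRank F W) (e + 1)) := by
  classical
  obtain ⟨w₀, -, -, hw₀⟩ := exists_finrank_eq_between (bot_le : (⊥ : Submodule F W) ≤ ⊤)
    (j := e) (by simp) (by rw [finrank_top]; omega)
  obtain ⟨u₀, -, -, hu₀⟩ := exists_finrank_eq_between (bot_le : (⊥ : Submodule F W) ≤ ⊤)
    (j := e + 1) (by simp) (by rw [finrank_top]; omega)
  obtain ⟨c₀, hc₀⟩ := exists_isCompl w₀
  have hc₀' := Submodule.finrank_add_eq_of_isCompl hc₀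
  have hlt : lineCount F u₀ < lineCount F c₀ := lineCount_lt_lineCount (by omega)
  have hmul := Finset.card_mul_le_card_mul
    (s := (Finset.univ : Finset (Level (dimRank F W) e)))
    (t := (Finset.univ : Finset (Level (dimRank F W) (e + 1)))) (fun w u => w.1 ≤ u.1)
    (m := lineCount F c₀) (n := lineCount F u₀) (fun w _ => ?_) fun u _ => ?_
  · rw [Finset.card_univ, Finset.card_univ, ← Nat.card_eq_fintype_card,
      ← Nat.card_eq_fintype_card] at hmul
    have hpos : 0 < Nat.card (Level (dimRank F W) e) :=
      have : Nonempty (Level (dimRank F W) e) := ⟨⟨w₀, hw₀⟩⟩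
      Nat.card_pos
    by_contra! hle
    have h₁ := Nat.mul_le_mul_right (lineCount F u₀) hle
    exact absurd (Nat.le_of_mul_le_mul_left (hmul.trans h₁) hpos) (by omega)
  · obtain ⟨c, hc⟩ := exists_isCompl w.1
    have hc' := Submodule.finrank_add_eq_of_isCompl hc
    have hw : Module.finrank F w.1 = e := w.2
    rw [lineCount_congr (W := c₀) (W' := c) (by omega)]
    refine (lineCount_le_card_cover hw hc).trans ?_
    rw [Finset.bipartiteAbove, ← Fintype.card_subtype, ← Nat.card_eq_fintype_card]
    exact Nat.card_le_card_of_injective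
      (fun u => (⟨⟨u.1, u.2.1⟩, u.2.2⟩ : {u : Level (dimRank F W) (e + 1) // w.1 ≤ u.1}))
      fun u u' huu' => Subtype.ext (congrArg (fun v => v.1.1) huu')
  · have hu : Module.finrank F u.1 = e + 1 := u.2
    rw [lineCount_congr (W := u₀) (W' := u.1) (by omega)]
    refine le_trans ?_ (card_hyperplane_le hu)
    rw [Finset.bipartiteBelow, ← Fintype.card_subtype, ← Nat.card_eq_fintype_card]
    exact Nat.card_le_card_of_injective
      (fun w => (⟨w.1.1, w.1.2, w.2⟩ :
        {w : Submodule F W // Module.finrank F w = e ∧ w ≤ u.1}))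
      fun w w' hww' => by
        have := congrArg Subtype.val hww'
        exact Subtype.ext (Subtype.ext this)

variable (F W) in
theorem hasTightFrames_grassmann (k : ℕ) (hk : 2 * k ≤ Module.finrank F W) :
    HasTightFrames (dimRank F W) k (grassmann F W k) := by
  refine (homogeneousSemilattice_dimRank (by omega)).hasTightFrames (fun _ _ => Iff.rfl) ?_
  rintro e rfl
  exact Lam_ne_top_of_card_lt (card_level_dimRank_lt hk)

end Counting

end LevelFrame

theorem theorem5p1 :
    (∀ n k : ℕ, 2 * k ≤ n →
      LevelFrame.HasTightFrames (LevelFrame.setRank n) k (LevelFrame.johnson n k)) ∧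
    (∀ (F : Type*) (W : Type*) [Field F] [Finite F] [AddCommGroup W] [Module F W]
      [FiniteDimensional F W] (k : ℕ), 2 * k ≤ Module.finrank F W →
      LevelFrame.HasTightFrames (LevelFrame.dimRank F W) k (LevelFrame.grassmann F W k)) ∧
    (∀ n : ℕ,
      LevelFrame.HasTightFrames (LevelFrame.wordRank n) n (LevelFrame.hypercube n)) :=
  ⟨LevelFrame.hasTightFrames_johnson,
    fun F W _ _ _ _ _ => LevelFrame.hasTightFrames_grassmann F W,
    LevelFrame.hasTightFrames_hypercube⟩
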